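/- A signature $(\mathbb L,\mathbb U)$ consists of a collection $\mathbb L$ of predicate and function symbols of various arities and a nonempty collection $\mathbb U$ of nonempty sets of natural numbers. Formulas are built from the symbols of $\mathbb L$, identity and the variables $v_0,v_1,\dots$ by $\neg$, $\wedge$, $\exists$ and the binary connectives $\succeq_X$ ($X\in\mathbb U$). A preorder model $\langle D,W,t,\unrhd,s\rangle$ consists of a nonempty domain $D$, a nonempty set $W$ of worlds, an interpretation $t(w,\cdot)$ over $D$ of the symbols of $\mathbb L$ at each world $w$, a total preorder $\unrhd_X$ on $W$ for each $X\in\mathbb U$, and a function $s$ with $s(w,A)\in A$ for all $w\in W$ and $\emptyset\ne A\subseteq W$. For an assignment $d$ of elements of $D$ to the variables, each formula $\varphi$ expresses a set $\varphi[d]\subseteq W$: the first-order clauses are evaluated at each world as usual, with quantifiers over $D$ and symbols interpreted at that world; $(\theta\succeq_X\psi)[d]$ is empty if $\theta[d]$ or $\psi[d]$ is empty, and otherwise equals $\{w\in W: s(w,\theta[d])\unrhd_X s(w,\psi[d])\}$. A utility model has functions $u_X:W\to\mathbb R$ in place of the preorders, and $w\unrhd_X w'$ is read as $u_X(w)\ge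 u_X(w')$. A formula is valid in a class of models if $\varphi[d]=W$ for every model in the class and every assignment $d$. An effective enumeration of $(\mathbb L,\mathbb U)$ names predicate symbols, function symbols and members of $\mathbb U$ by natural numbers, so that every item has at least one name, the sets of names are recursively enumerable, and the arity of a symbol is computable from any of its names. It induces a standard Gödel numbering of formulas, in which each $\succeq_X$ is coded by a name of $X$. A set $S$ of formulas is effectively enumerable if there is a recursively enumerable set of numbers each of which is a Gödel number of a member of $S$ and which contains a Gödel number of every member of $S$. Proposition. Let $(\mathbb L,\mathbb U)$ be a signature with an effective enumeration. Then the set of formulas valid in all preorder models is effectively enumerable, and so is the set of formulas valid in all utility models. -/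

import Mathlib

universe u v

namespace PrefLogic

/-- A signature: a vocabulary of predicate and function symbols of various arities, and a
nonempty collection of nonempty sets of natural numbers (the utility indices). -/
structure Signature where
  L : FirstOrder.Language.{0, 0}
  U : Set (Set ℕ)
  U_nonempty : U.Nonempty
  nonempty_of_mem : ∀ X ∈ U, X.Nonempty

/-- Terms, with individual variables `v₀, v₁, …`. -/
abbrev Signature.Term (σ : Signature) : Type := σ.L.Term ℕ

/-- Formulas of quantified preference logic; `pref X φ ψ` is `φ ⪰_X ψ`. -/
inductive Formula (σ : Signature) : Type
  | equal (t₁ t₂ : σ.Term) : Formula σ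
  | rel {n : ℕ} (R : σ.L.Relations n) (ts : Fin n → σ.Term) : Formula σ
  | neg (φ : Formula σ) : Formula σ
  | conj (φ ψ : Formula σ) : Formula σ
  | ex (x : ℕ) (φ : Formula σ) : Formula σ
  | pref (X : σ.U) (φ ψ : Formula σ) : Formula σ

/-- The components `⟨D, W, t, s⟩` that utility models and preorder models share: a nonempty
domain, a nonempty set of worlds, an interpretation of the vocabulary at each world, and a
selection function choosing a member of every nonempty set of worlds. -/
structure Core (σ : Signature) where
  D : Type u
  W : Type v
  D_nonempty : Nonempty D
  W_nonempty : Nonempty W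
  t : W → σ.L.Structure D
  s : W → {A : Set W // A.Nonempty} → W
  s_mem : ∀ w A, s w A ∈ A.1

/-- The value at the world `w` of a term under the assignment `d`. -/
def Core.termVal {σ : Signature} (M : Core.{u, v} σ) (w : M.W) (d : ℕ → M.D) (τ : σ.Term) : M.D :=
  letI := M.t w
  FirstOrder.Language.Term.realize d τ

/-- The proposition (set of worlds) expressed by a formula under an assignment, where
`ge X w w'` says that the world `w` is at least as good as `w'` according to `X`. In the last
clause the value is empty if one of the two compared propositions is empty. -/
def Core.prop {σ : Signature} (M : Core.{u, v} σ) (ge : σ.U → M.W → M.W → Prop) :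
    Formula σ → (ℕ → M.D) → Set M.W
  | .equal τ₁ τ₂, d => {w | M.termVal w d τ₁ = M.termVal w d τ₂}
  | .rel R ts, d => {w | (M.t w).RelMap R fun i => M.termVal w d (ts i)}
  | .neg φ, d => (M.prop ge φ d)ᶜ
  | .conj φ ψ, d => M.prop ge φ d ∩ M.prop ge ψ d
  | .ex x φ, d => {w | ∃ a : M.D, w ∈ M.prop ge φ (Function.update d x a)}
  | .pref X φ ψ, d =>
      {w | ∃ (hφ : (M.prop ge φ d).Nonempty) (hψ : (M.prop ge ψ d).Nonempty),
        ge X (M.s w ⟨M.prop ge φ d, hφ⟩) (M.s w ⟨M.prop ge ψ d, hψ⟩)}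

/-- A (utility) model: each `X ∈ U` comes with a real-valued utility function on worlds. -/
structure UtilityModel (σ : Signature) extends Core.{u, v} σ where
  util : σ.U → W → ℝ

/-- The proposition expressed by a formula in a utility model. -/
def UtilityModel.prop {σ : Signature} (M : UtilityModel.{u, v} σ) (φ : Formula σ)
    (d : ℕ → M.D) : Set M.W :=
  M.toCore.prop (fun X w w' => M.util X w ≥ M.util X w') φ d

/-- A preorder model: each `X ∈ U` comes with a total preorder on worlds. -/
structure PreorderModel (σ : Signature) extends Core.{u, v} σ where
  ge : σ.U → W → W → Prop
  ge_refl : ∀ X w, ge X w w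
  ge_trans : ∀ X w₁ w₂ w₃, ge X w₁ w₂ → ge X w₂ w₃ → ge X w₁ w₃
  ge_total : ∀ X w₁ w₂, ge X w₁ w₂ ∨ ge X w₂ w₁

/-- The proposition expressed by a formula in a preorder model. -/
def PreorderModel.prop {σ : Signature} (M : PreorderModel.{u, v} σ) (φ : Formula σ)
    (d : ℕ → M.D) : Set M.W :=
  M.toCore.prop M.ge φ d

/-- `φ` holds at all worlds, under all assignments, in all utility models. -/
def UtilityValid {σ : Signature} (φ : Formula σ) : Prop :=
  ∀ (M : UtilityModel.{u, v} σ) (d : ℕ → M.D), M.prop φ d = Set.univ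

/-- `φ` holds at all worlds, under all assignments, in all preorder models. -/
def PreorderValid {σ : Signature} (φ : Formula σ) : Prop :=
  ∀ (M : PreorderModel.{u, v} σ) (d : ℕ → M.D), M.prop φ d = Set.univ

/-- An effective enumeration of a signature: natural numbers serve as names of the predicate
symbols, of the function symbols and of the members of `U` (`none`: the number names nothing).
Every item has at least one name, the sets of names are recursively enumerable, and the arity of
a symbol can be computed from a name of it. Names may be unique, but need not be; the sets
of names of symbols may be empty, finite or infinite. In (the code of) a formula the connective `⪰_X` is given by a
name of `X`. -/
structure EffectiveEnumeration (σ : Signature) where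
  rel : ℕ → Option (Σ n, σ.L.Relations n)
  rel_surj : ∀ R, ∃ k, rel k = some R
  rel_arity : Partrec fun k => Part.ofOption ((rel k).map Sigma.fst)
  func : ℕ → Option (Σ n, σ.L.Functions n)
  func_surj : ∀ f, ∃ k, func k = some f
  func_arity : Partrec fun k => Part.ofOption ((func k).map Sigma.fst)
  index : ℕ → Option σ.U
  index_surj : ∀ X, ∃ k, index k = some X
  index_re : REPred fun k => (index k).isSome = true

/-- `TermCode ν c τ`: the number `c` is a Gödel number of the term `τ`. -/
inductive TermCode {σ : Signature} (ν : EffectiveEnumeration σ) : ℕ → σ.Term → Prop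
  | var (x : ℕ) : TermCode ν (Nat.pair 0 x) (FirstOrder.Language.var x)
  | func {n k : ℕ} {f : σ.L.Functions n} {c : Fin n → ℕ} {ts : Fin n → σ.Term}
      (hk : ν.func k = some ⟨n, f⟩) (hc : ∀ i, TermCode ν (c i) (ts i)) :
      TermCode ν (Nat.pair 1 (Nat.pair k (Encodable.encode (List.ofFn c))))
        (FirstOrder.Language.func f ts)

/-- `FormulaCode ν c φ`: the number `c` is a Gödel number of the formula `φ`. -/
inductive FormulaCode {σ : Signature} (ν : EffectiveEnumeration σ) : ℕ → Formula σ → Prop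
  | equal {a b : ℕ} {τ₁ τ₂ : σ.Term} (ha : TermCode ν a τ₁) (hb : TermCode ν b τ₂) :
      FormulaCode ν (Nat.pair 0 (Nat.pair a b)) (.equal τ₁ τ₂)
  | rel {n k : ℕ} {R : σ.L.Relations n} {c : Fin n → ℕ} {ts : Fin n → σ.Term}
      (hk : ν.rel k = some ⟨n, R⟩) (hc : ∀ i, TermCode ν (c i) (ts i)) :
      FormulaCode ν (Nat.pair 1 (Nat.pair k (Encodable.encode (List.ofFn c)))) (.rel R ts)
  | neg {a : ℕ} {φ : Formula σ} (ha : FormulaCode ν a φ) :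
      FormulaCode ν (Nat.pair 2 a) (.neg φ)
  | conj {a b : ℕ} {φ ψ : Formula σ} (ha : FormulaCode ν a φ) (hb : FormulaCode ν b ψ) :
      FormulaCode ν (Nat.pair 3 (Nat.pair a b)) (.conj φ ψ)
  | ex {a : ℕ} (x : ℕ) {φ : Formula σ} (ha : FormulaCode ν a φ) :
      FormulaCode ν (Nat.pair 4 (Nat.pair x a)) (.ex x φ)
  | pref {k a b : ℕ} {X : σ.U} {φ ψ : Formula σ} (hk : ν.index k = some X)
      (ha : FormulaCode ν a φ) (hb : FormulaCode ν b ψ) :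
      FormulaCode ν (Nat.pair 5 (Nat.pair k (Nat.pair a b))) (.pref X φ ψ)

/-- A set of formulas is effectively enumerable if some recursively enumerable set of numbers
consists of Gödel numbers of members of the set and contains a Gödel number of each member. If
names in `ν` are unique, then so are Gödel numbers, and this says that the set of all Gödel
numbers of members is recursively enumerable. -/
def EffectivelyEnumerable {σ : Signature} (ν : EffectiveEnumeration σ)
    (S : Set (Formula σ)) : Prop :=
  ∃ C : ℕ → Prop, REPred C ∧ (∀ c, C c → ∃ φ ∈ S, FormulaCode ν c φ) ∧
    ∀ φ ∈ S, ∃ c, C c ∧ FormulaCode ν c φ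

end PrefLogic

-- Preorder validity and utility validity both amount to one condition on Gödel numbers, `Entailed`,
-- whose recursive enumerability comes from propositional compactness. A model whose individuals and
-- worlds all have numerical names is recorded by a valuation of propositional atoms: truth at a
-- world, values of terms, equality, preference. Being such a record is axiomatised by finite
-- clauses, given by finitely many primitive recursive schemes with Henkin witnesses built in
-- (`Describes`). A consequence of such clauses is certified by a finite truth table, so
-- consequences are r.e. (`rePred_entailed`). The three properties form a circle. Names can be
-- interpreted in any preorder model, so entailed formulas are preorder valid
-- (`Core.exists_describes`). Utilities induce total preorders, so preorder validity implies utility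
-- validity. Conversely, a describing valuation yields a model with countably many worlds satisfying
-- the truth lemma `Describes.prop_eq`; a countable total preorder is represented by real utilities
-- (`exists_utility`), so utility valid formulas are entailed. The delicate point is the selection
-- function, whose arguments are sets of worlds. Formulas see it only on propositions expressed by
-- formulas with parameters, and only up to indifference. So it suffices that two descriptions of
-- the same proposition select indifferent worlds. This becomes a clause condition through a Skolem
-- world at which two propositions differ if they differ at all (`differCode`).

namespace PrefLogic

-- Propositional compactness and enumerability of consequences

section Entailment

open Encodable

/-- A clause, given by its list of premises and its list of alternative conclusions. -/
abbrev Clause (α : Type) := List α × List α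

/-- The clause `c` holds under the valuation `v`. -/
def Clause.Holds {α : Type} (v : α → Prop) (c : Clause α) : Prop :=
  (∀ a ∈ c.1, v a) → ∃ b ∈ c.2, v b

/-- The bits of `A` below `N`, read as a partial valuation, falsify the clause `c`. -/
def Clause.Falsified {α : Type} [Encodable α] (N A : ℕ) (c : Clause α) : Prop :=
  (∀ a ∈ c.1, encode a < N ∧ A / 2 ^ encode a % 2 = 1) ∧
    ∀ b ∈ c.2, encode b < N ∧ A / 2 ^ encode b % 2 ≠ 1

theorem primrec_two_pow : Primrec fun n : ℕ => 2 ^ n :=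
  (Primrec.nat_rec₁ (f := fun _ m => 2 * m) 1
    (Primrec.nat_mul.comp (Primrec.const 2) Primrec.snd).to₂).of_eq fun n => by
    induction n with
    | zero => rfl
    | succ n ih => simp only [pow_succ', ← ih]

theorem primrecRel_bit : PrimrecRel fun A i : ℕ => A / 2 ^ i % 2 = 1 :=
  Primrec.eq.comp₂ (Primrec.nat_mod.comp (Primrec.nat_div.comp Primrec.fst
    (primrec_two_pow.comp Primrec.snd)) (Primrec.const 2)) (Primrec₂.const 1)

theorem primrecPred_falsified {α : Type} [Primcodable α] :
    PrimrecPred fun x : (ℕ × ℕ) × Clause α => x.2.Falsified x.1.1 x.1.2 := by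
  have hlt : PrimrecRel fun (a : α) (y : ℕ × ℕ) => encode a < y.1 :=
    Primrec.nat_lt.comp (Primrec.encode.comp Primrec.fst) (Primrec.fst.comp Primrec.snd)
  have hbit : PrimrecRel fun (a : α) (y : ℕ × ℕ) => y.2 / 2 ^ encode a % 2 = 1 :=
    primrecRel_bit.comp (Primrec.snd.comp Primrec.snd) (Primrec.encode.comp Primrec.fst)
  have h1 := PrimrecRel.forall_mem_list
    (R := fun (a : α) (y : ℕ × ℕ) => encode a < y.1 ∧ y.2 / 2 ^ encode a % 2 = 1)
    (PrimrecPred.and hlt hbit)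
  have h2 := PrimrecRel.forall_mem_list
    (R := fun (a : α) (y : ℕ × ℕ) => encode a < y.1 ∧ y.2 / 2 ^ encode a % 2 ≠ 1)
    (PrimrecPred.and hlt (PrimrecPred.not hbit))
  exact (h1.comp (Primrec.fst.comp Primrec.snd) Primrec.fst).and
    (h2.comp (Primrec.snd.comp Primrec.snd) Primrec.fst)

theorem primrecRel_forall_lt {α : Type} [Primcodable α] {R : ℕ → α → Prop} (hR : PrimrecRel R) :
    PrimrecRel fun n y => ∀ x < n, R x y :=
  (hR.forall_mem_list.comp (Primrec.list_range.comp Primrec.fst) Primrec.snd).of_eq (by simp)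

theorem primrecRel_exists_lt {α : Type} [Primcodable α] {R : ℕ → α → Prop} (hR : PrimrecRel R) :
    PrimrecRel fun n y => ∃ x < n, R x y :=
  (hR.exists_mem_list.comp (Primrec.list_range.comp Primrec.fst) Primrec.snd).of_eq (by simp)

theorem rePred_exists {α : Type} [Primcodable α] {R : α → ℕ → Prop} (hR : PrimrecRel R) :
    REPred fun a => ∃ n, R a n := by
  classical
  have h := Partrec.rfind (p := fun a n => Part.some (decide (R a n)))
    (Computable.partrec (hR.decide.to_comp))
  refine h.dom_re.of_eq fun a => ?_
  refine Nat.rfind_dom.trans ?_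
  simp

/-- Compactness of the Cantor space `α → Bool`: the valuations passing the `N`-th test form a nested
sequence of nonempty closed sets. A point of the intersection satisfies every clause, since the
bound `N` eventually exceeds the codes of all its atoms. -/
theorem exists_valuation_of_finite {α : Type} [Encodable α] (f : ℕ → Clause α) (c : Clause α)
    (h : ∀ N, ∃ A < 2 ^ N, ¬ c.Falsified N A ∧ ∀ n < N, ¬ (f n).Falsified N A) :
    ∃ v : α → Prop, c.Holds v ∧ ∀ n, (f n).Holds v := by
  classical
  let Fals (N : ℕ) (c : Clause α) (v : α → Bool) : Prop :=
    (∀ a ∈ c.1, encode a < N ∧ v a = true) ∧ ∀ b ∈ c.2, encode b < N ∧ v b = false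
  have hclopen : ∀ N c, IsClopen {v | Fals N c v} := by
    intro N c
    have key : ∀ (b : Bool) (l : List α), IsClopen {v : α → Bool | ∀ a ∈ l, encode a < N ∧ v a = b} := by
      intro b l
      induction l with
      | nil => simp [isClopen_univ]
      | cons a l ih =>
        have : {v : α → Bool | ∀ x ∈ a :: l, encode x < N ∧ v x = b} =
            ({v | encode a < N} ∩ (fun v => v a) ⁻¹' {b}) ∩
              {v : α → Bool | ∀ x ∈ l, encode x < N ∧ v x = b} := by
          ext v; simp
        rw [this]
        refine IsClopen.inter (IsClopen.inter ?_ ?_) ih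
        · by_cases hN : encode a < N <;> simp [hN, isClopen_univ, isClopen_empty]
        · exact (isClopen_discrete _).preimage (continuous_apply a)
    exact (key true c.1).inter (key false c.2)
  have hmono : ∀ {N N' : ℕ} {c : Clause α} {v : α → Bool}, N ≤ N' → Fals N c v → Fals N' c v :=
    fun hN hF => ⟨fun a ha => ⟨(hF.1 a ha).1.trans_le hN, (hF.1 a ha).2⟩,
      fun a ha => ⟨(hF.2 a ha).1.trans_le hN, (hF.2 a ha).2⟩⟩
  let K (N : ℕ) : Set (α → Bool) := {v | ¬ Fals N c v ∧ ∀ n < N, ¬ Fals N (f n) v}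
  have hK : ∀ N, IsClosed (K N) := by
    intro N
    have : K N = {v | Fals N c v}ᶜ ∩ ⋂ n, ⋂ (_ : n < N), {v | Fals N (f n) v}ᶜ := by
      ext v; simp [K]
    rw [this]
    exact (hclopen N c).compl.1.inter
      (isClosed_iInter fun n => isClosed_iInter fun _ => (hclopen N (f n)).compl.1)
  obtain ⟨v, hv⟩ := IsCompact.nonempty_iInter_of_sequence_nonempty_isCompact_isClosed K
    (fun N v hv => ⟨fun hF => hv.1 (hmono N.le_succ hF), fun n hn hF =>
      hv.2 n (hn.trans N.lt_succ_self) (hmono N.le_succ hF)⟩)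
    (fun N => by
      obtain ⟨A, -, hc, hA⟩ := h N
      refine ⟨fun a => decide (A / 2 ^ encode a % 2 = 1), fun hF => hc ?_,
        fun n hn hF => hA n hn ?_⟩
      · simpa [Fals, Clause.Falsified] using hF
      · simpa [Fals, Clause.Falsified] using hF)
    (hK 0).isCompact hK
  rw [Set.mem_iInter] at hv
  have hlarge : ∀ c : Clause α, ∃ N, ∀ N' ≥ N, ¬ Fals N' c v → c.Holds fun a => v a = true := by
    intro c
    -- The sum is a crude strict upper bound on the codes of the atoms in the clause.
    refine ⟨((c.1 ++ c.2).map fun a => encode a + 1).sum, fun N' hN' hF hprem => ?_⟩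
    by_contra! hcon
    have hb : ∀ a ∈ c.1 ++ c.2, encode a < N' := fun a ha =>
      lt_of_lt_of_le (Nat.lt_of_succ_le (List.single_le_sum (by simp) _
        (List.mem_map_of_mem (f := fun a => encode a + 1) ha))) hN'
    exact hF ⟨fun a ha => ⟨hb a (List.mem_append_left _ ha), hprem a ha⟩,
      fun a ha => ⟨hb a (List.mem_append_right _ ha), by simpa using hcon a ha⟩⟩
  refine ⟨fun a => v a = true, ?_, fun n => ?_⟩
  · obtain ⟨N, hN⟩ := hlarge c
    exact hN N le_rfl (hv N).1
  · obtain ⟨N, hN⟩ := hlarge (f n)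
    exact hN (max N (n + 1)) (le_max_left _ _)
      ((hv _).2 n (lt_of_lt_of_le n.lt_succ_self (le_max_right _ _)))

/-- Take for `A` the number whose bits below `N` are the truth values under `v`; then falsification
by these bits is genuine falsification. -/
theorem exists_falsified {α : Type} [Encodable α] (v : α → Prop) (N : ℕ) :
    ∃ A < 2 ^ N, ∀ c : Clause α, c.Falsified N A → ¬ c.Holds v := by
  classical
  let A := Nat.ofBits fun i : Fin N => decide (∃ a : α, encode a = i ∧ v a)
  have hA : ∀ a : α, encode a < N → (A / 2 ^ encode a % 2 = 1 ↔ v a) := by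
    intro a ha
    have h := Nat.testBit_ofBits_lt (fun i : Fin N => decide (∃ a : α, encode a = i ∧ v a)) _ ha
    rw [Nat.testBit_eq_decide_div_mod_eq] at h
    have h' := (decide_eq_decide.mp h)
    rw [h']
    constructor
    · rintro ⟨b, hb, hvb⟩
      rwa [← encode_injective hb]
    · exact fun hv => ⟨a, rfl, hv⟩
  refine ⟨A, Nat.ofBits_lt_two_pow _, fun c hc hh => ?_⟩
  obtain ⟨b, hb, hvb⟩ := hh fun a ha => (hA a (hc.1 a ha).1).1 (hc.1 a ha).2
  exact (hc.2 b hb).2 ((hA b (hc.2 b hb).1).2 hvb)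

/-- The atoms entailed by a primitive recursive sequence of clauses form an r.e. set. -/
theorem rePred_entailed {α : Type} [Primcodable α] {f : ℕ → Clause α} (hf : Primrec f) :
    REPred fun a => ∀ v : α → Prop, (∀ n, (f n).Holds v) → v a := by
  -- The clause `([a], [])` denies `a`. A certificate for `a` is an `N` such that every row of the
  -- truth table on `N` bits falsifies this denial or one of the first `N` clauses.
  have hroot : PrimrecRel fun (A : ℕ) (y : α × ℕ) => Clause.Falsified y.2 A ([y.1], []) := by
    refine (primrecPred_falsified (α := α)).comp (((Primrec.snd.comp Primrec.snd).pair
      Primrec.fst).pair (Primrec.pair ?_ (Primrec.const [])))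
    exact Primrec.list_cons.comp (Primrec.fst.comp Primrec.snd) (Primrec.const [])
  have hbase : PrimrecRel fun (n : ℕ) (y : ℕ × ℕ) => (f n).Falsified y.2 y.1 :=
    (primrecPred_falsified (α := α)).comp (((Primrec.snd.comp Primrec.snd).pair
      (Primrec.fst.comp Primrec.snd)).pair (hf.comp Primrec.fst))
  have hbounded := primrecRel_exists_lt
    (R := fun (n : ℕ) (y : ℕ × ℕ) => (f n).Falsified y.2 y.1) hbase
  have hfam : PrimrecRel fun (A : ℕ) (y : α × ℕ) => ∃ n < y.2, (f n).Falsified y.2 A :=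
    hbounded.comp (Primrec.snd.comp Primrec.snd)
      (Primrec.fst.pair (Primrec.snd.comp Primrec.snd))
  have hall := primrecRel_forall_lt (R := fun (A : ℕ) (y : α × ℕ) =>
    Clause.Falsified y.2 A ([y.1], []) ∨ ∃ n < y.2, (f n).Falsified y.2 A)
    (PrimrecPred.or hroot hfam)
  have hcheck : PrimrecRel fun (a : α) (N : ℕ) => ∀ A < 2 ^ N,
      Clause.Falsified N A ([a], []) ∨ ∃ n < N, (f n).Falsified N A :=
    hall.comp (primrec_two_pow.comp Primrec.snd) (Primrec.fst.pair Primrec.snd)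
  refine (rePred_exists hcheck).of_eq fun a => ⟨?_, ?_⟩
  · rintro ⟨N, hN⟩ v hv
    obtain ⟨A, hA, hF⟩ := exists_falsified v N
    rcases hN A hA with h | ⟨n, -, h⟩
    · by_contra hva
      exact hF _ h fun hp => absurd (hp a (by simp)) hva
    · exact absurd (hv n) (hF _ h)
  · intro h
    by_contra! hcon
    obtain ⟨v, hc, hv⟩ := exists_valuation_of_finite f ([a], []) hcon
    obtain ⟨b, hb, -⟩ := hc fun b hb => by
      rw [List.mem_singleton.mp hb]; exact h v hv
    simp at hb

/-- The atoms entailed by finitely many primitive recursive clause schemes form an r.e. set. -/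
theorem rePred_entailed_of_schemes {α β : Type} [Primcodable α] [Primcodable β] [Inhabited α]
    [Inhabited β] (fs : List (β → Clause α)) (hfs : ∀ f ∈ fs, Primrec f) :
    REPred fun a => ∀ v : α → Prop, (∀ f ∈ fs, ∀ p, (f p).Holds v) → v a := by
  let F (x : ℕ × β) : Clause α :=
    -- Indices outside the list of schemes yield a tautology, so the merged sequence adds nothing.
    (fs.map fun f => f x.2).getD x.1 ([default], [default])
  have hmap : Primrec fun x : ℕ × β => fs.map fun f => f x.2 := by
    clear F
    induction fs with
    | nil => exact Primrec.const []
    | cons f fs ih =>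
      exact Primrec.list_cons.comp ((hfs f (by simp)).comp Primrec.snd)
        (ih fun g hg => hfs g (by simp [hg]))
  have hF : Primrec F := (Primrec.list_getD _).comp hmap Primrec.fst
  have hseq : Primrec fun n : ℕ => F ((decode n).getD (0, default)) :=
    hF.comp (Primrec.option_getD.comp Primrec.decode (Primrec.const _))
  refine (rePred_entailed hseq).of_eq fun a => forall_congr' fun v => ?_
  refine imp_congr_left ⟨fun h f hf p => ?_, fun h n => ?_⟩
  · obtain ⟨i, hi, rfl⟩ := List.getElem_of_mem hf
    simpa [F, hi] using h (encode (i, p))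
  · generalize (decode n).getD ((0, default) : ℕ × β) = x
    by_cases hi : x.1 < fs.length
    · simpa [F, hi] using h _ (List.getElem_mem hi) x.2
    · simp only [F]
      rw [List.getD_eq_default _ _ (by simpa using hi)]
      exact fun hp => ⟨default, by simp, hp _ (by simp)⟩

end Entailment

-- Clauses describing a model with named individuals and worlds

section Theory

/-! Individuals, worlds and environments (finite lists of pairs of a variable and an individual)
are coded by natural numbers. An individual is the default value `⟨0, x⟩` of a variable `v_x`,
a witness of an existential formula or the value of a term. A world is the base world `0`, a
selected world, or a world at which two propositions differ if they differ at all. -/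

/-- The code of a list with head `a` and tail `l`. -/
def consCode (a l : ℕ) : ℕ := (Nat.pair a l).succ

/-- The environment `e` updated with the value `a` of the variable `v_x`. -/
def updateCode (x a e : ℕ) : ℕ := consCode (Nat.pair x a) e

/-- An individual that makes the existential formula `∃ v_x c` true at `w`, if there is one. -/
def witnessCode (w x c e : ℕ) : ℕ := Nat.pair 1 (Nat.pair w (Nat.pair x (Nat.pair c e)))

/-- The value of the term `t` at the world `w`. -/
def valueCode (w t e : ℕ) : ℕ := Nat.pair 2 (Nat.pair w (Nat.pair t e))

/-- The world selected at `w` from the proposition expressed by `c`. -/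
def selectCode (w c e : ℕ) : ℕ := Nat.pair 1 (Nat.pair w (Nat.pair c e))

/-- A world at which the propositions expressed by `c` and `c'` differ, if there is one. -/
def differCode (c e c' e' : ℕ) : ℕ := Nat.pair 2 (Nat.pair (Nat.pair c e) (Nat.pair c' e'))

/-- The formula `c` holds at `w`. -/
def trueAtom (w c e : ℕ) : List ℕ := [0, w, c, e]

/-- The term `t` has the value `a` at `w`. -/
def valAtom (w t e a : ℕ) : List ℕ := [1, w, t, e, a]

/-- The list of terms `l` has the list of values `b` at `w`. -/
def valsAtom (w l e b : ℕ) : List ℕ := [2, w, l, e, b]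

/-- The individuals `a` and `b` are equal. -/
def eqAtom (a b : ℕ) : List ℕ := [3, a, b]

/-- The world `w` is at least as good as `w'` according to the index named `k`. -/
def geAtom (k w w' : ℕ) : List ℕ := [4, k, w, w']

/-- The number `t` is a code of a term. -/
def termAtom (t : ℕ) : List ℕ := [0, t]

/-- The number `l` is a code of a list of terms of length `n`. -/
def termsAtom (l n : ℕ) : List ℕ := [1, l, n]

/-- The number `c` is a code of a formula. -/
def formulaAtom (c : ℕ) : List ℕ := [2, c]

/-- The valuation `v` describes a model in which every individual and every world has a name. -/
structure Describes (v : List ℕ → Prop) : Prop where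
  var_nil : ∀ w x, v (valAtom w (Nat.pair 0 x) 0 (Nat.pair 0 x))
  var_head : ∀ w x a e, v (valAtom w (Nat.pair 0 x) (updateCode x a e) a)
  var_tail : ∀ w x a e y b, x ≠ y → v (valAtom w (Nat.pair 0 y) e b) →
    v (valAtom w (Nat.pair 0 y) (updateCode x a e) b)
  val_total : ∀ w t e, v (valAtom w t e (valueCode w t e))
  val_unique : ∀ w t e a b, v (valAtom w t e a) → v (valAtom w t e b) → v (eqAtom a b)
  val_congr : ∀ w t e a b, v (valAtom w t e a) → v (eqAtom a b) → v (valAtom w t e b)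
  eq_refl : ∀ a, v (eqAtom a a)
  eq_symm : ∀ a b, v (eqAtom a b) → v (eqAtom b a)
  eq_trans : ∀ a b c, v (eqAtom a b) → v (eqAtom b c) → v (eqAtom a c)
  vals_nil : ∀ w e, v (valsAtom w 0 e 0)
  vals_cons : ∀ w t l e a b, v (valAtom w t e a) → v (valsAtom w l e b) →
    v (valsAtom w (consCode t l) e (consCode a b))
  -- There are no atoms for graphs of functions or relations: they are read off from compound terms
  -- and atomic formulas. The congruences make this independent of the argument terms and the
  -- environment.
  func_congr : ∀ w k l e l' e' a b, v (valsAtom w l e b) → v (valsAtom w l' e' b) →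
    v (valAtom w (Nat.pair 1 (Nat.pair k l)) e a) →
      v (valAtom w (Nat.pair 1 (Nat.pair k l')) e' a)
  rel_congr : ∀ w k l e l' e' b, v (valsAtom w l e b) → v (valsAtom w l' e' b) →
    v (trueAtom w (Nat.pair 1 (Nat.pair k l)) e) → v (trueAtom w (Nat.pair 1 (Nat.pair k l')) e')
  equal_elim : ∀ w s t e a b, v (trueAtom w (Nat.pair 0 (Nat.pair s t)) e) → v (valAtom w s e a) →
    v (valAtom w t e b) → v (eqAtom a b)
  equal_intro : ∀ w s t e a, v (valAtom w s e a) → v (valAtom w t e a) →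
    v (trueAtom w (Nat.pair 0 (Nat.pair s t)) e)
  neg_elim : ∀ w c e, v (trueAtom w (Nat.pair 2 c) e) → ¬ v (trueAtom w c e)
  neg_intro : ∀ w c e, v (trueAtom w (Nat.pair 2 c) e) ∨ v (trueAtom w c e)
  conj_left : ∀ w c c' e, v (trueAtom w (Nat.pair 3 (Nat.pair c c')) e) → v (trueAtom w c e)
  conj_right : ∀ w c c' e, v (trueAtom w (Nat.pair 3 (Nat.pair c c')) e) → v (trueAtom w c' e)
  conj_intro : ∀ w c c' e, v (trueAtom w c e) → v (trueAtom w c' e) →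
    v (trueAtom w (Nat.pair 3 (Nat.pair c c')) e)
  ex_elim : ∀ w x c e, v (trueAtom w (Nat.pair 4 (Nat.pair x c)) e) →
    v (trueAtom w c (updateCode x (witnessCode w x c e) e))
  ex_intro : ∀ w x c e a, v (trueAtom w c (updateCode x a e)) →
    v (trueAtom w (Nat.pair 4 (Nat.pair x c)) e)
  pref_left : ∀ w k c c' e, v (trueAtom w (Nat.pair 5 (Nat.pair k (Nat.pair c c'))) e) →
    v (trueAtom (selectCode w c e) c e)
  pref_right : ∀ w k c c' e, v (trueAtom w (Nat.pair 5 (Nat.pair k (Nat.pair c c'))) e) →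
    v (trueAtom (selectCode w c' e) c' e)
  pref_ge : ∀ w k c c' e, v (trueAtom w (Nat.pair 5 (Nat.pair k (Nat.pair c c'))) e) →
    v (geAtom k (selectCode w c e) (selectCode w c' e))
  pref_intro : ∀ w k c c' e, v (trueAtom (selectCode w c e) c e) →
    v (trueAtom (selectCode w c' e) c' e) → v (geAtom k (selectCode w c e) (selectCode w c' e)) →
      v (trueAtom w (Nat.pair 5 (Nat.pair k (Nat.pair c c'))) e)
  select : ∀ w w' c e, v (trueAtom w' c e) → v (trueAtom (selectCode w c e) c e)
  -- Together with `differ_neg`: unless the two propositions disagree at the world `differCode`,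
  -- their selected worlds stand in the preference relation for every index name.
  differ_pos : ∀ k w c e c' e', v (trueAtom (differCode c e c' e') c e) →
    v (trueAtom (differCode c e c' e') c' e') →
      v (geAtom k (selectCode w c e) (selectCode w c' e'))
  differ_neg : ∀ k w c e c' e', v (trueAtom (differCode c e c' e') c e) ∨
    v (trueAtom (differCode c e c' e') c' e') ∨
      v (geAtom k (selectCode w c e) (selectCode w c' e'))
  ge_total : ∀ k w w', v (geAtom k w w') ∨ v (geAtom k w' w)
  ge_trans : ∀ k w w' w'', v (geAtom k w w') → v (geAtom k w' w'') → v (geAtom k w w'')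

/-- Clause schemes for `Describes`, whose parameters are the entries of a list. -/
def describesSchemes : List (List ℕ → Clause (List ℕ)) :=
  let r (i : ℕ) (p : List ℕ) : ℕ := p.getD i 0
  [fun p => ([], [valAtom (r 0 p) (Nat.pair 0 (r 1 p)) 0 (Nat.pair 0 (r 1 p))]),
    fun p => ([], [valAtom (r 0 p) (Nat.pair 0 (r 1 p)) (updateCode (r 1 p) (r 2 p) (r 3 p))
      (r 2 p)]),
    -- The side condition `x ≠ y` is decided inside the scheme; when it fails the clause repeats its
    -- premise as conclusion.
    fun p => ([valAtom (r 0 p) (Nat.pair 0 (r 4 p)) (r 3 p) (r 5 p)],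
      [if r 1 p = r 4 p then valAtom (r 0 p) (Nat.pair 0 (r 4 p)) (r 3 p) (r 5 p)
        else valAtom (r 0 p) (Nat.pair 0 (r 4 p)) (updateCode (r 1 p) (r 2 p) (r 3 p)) (r 5 p)]),
    fun p => ([], [valAtom (r 0 p) (r 1 p) (r 2 p) (valueCode (r 0 p) (r 1 p) (r 2 p))]),
    fun p => ([valAtom (r 0 p) (r 1 p) (r 2 p) (r 3 p), valAtom (r 0 p) (r 1 p) (r 2 p) (r 4 p)],
      [eqAtom (r 3 p) (r 4 p)]),
    fun p => ([valAtom (r 0 p) (r 1 p) (r 2 p) (r 3 p), eqAtom (r 3 p) (r 4 p)],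
      [valAtom (r 0 p) (r 1 p) (r 2 p) (r 4 p)]),
    fun p => ([], [eqAtom (r 0 p) (r 0 p)]),
    fun p => ([eqAtom (r 0 p) (r 1 p)], [eqAtom (r 1 p) (r 0 p)]),
    fun p => ([eqAtom (r 0 p) (r 1 p), eqAtom (r 1 p) (r 2 p)], [eqAtom (r 0 p) (r 2 p)]),
    fun p => ([], [valsAtom (r 0 p) 0 (r 1 p) 0]),
    fun p => ([valAtom (r 0 p) (r 1 p) (r 3 p) (r 4 p), valsAtom (r 0 p) (r 2 p) (r 3 p) (r 5 p)],
      [valsAtom (r 0 p) (consCode (r 1 p) (r 2 p)) (r 3 p) (consCode (r 4 p) (r 5 p))]),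
    fun p => ([valsAtom (r 0 p) (r 2 p) (r 3 p) (r 7 p), valsAtom (r 0 p) (r 4 p) (r 5 p) (r 7 p),
      valAtom (r 0 p) (Nat.pair 1 (Nat.pair (r 1 p) (r 2 p))) (r 3 p) (r 6 p)],
      [valAtom (r 0 p) (Nat.pair 1 (Nat.pair (r 1 p) (r 4 p))) (r 5 p) (r 6 p)]),
    fun p => ([valsAtom (r 0 p) (r 2 p) (r 3 p) (r 6 p), valsAtom (r 0 p) (r 4 p) (r 5 p) (r 6 p),
      trueAtom (r 0 p) (Nat.pair 1 (Nat.pair (r 1 p) (r 2 p))) (r 3 p)],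
      [trueAtom (r 0 p) (Nat.pair 1 (Nat.pair (r 1 p) (r 4 p))) (r 5 p)]),
    fun p => ([trueAtom (r 0 p) (Nat.pair 0 (Nat.pair (r 1 p) (r 2 p))) (r 3 p),
      valAtom (r 0 p) (r 1 p) (r 3 p) (r 4 p), valAtom (r 0 p) (r 2 p) (r 3 p) (r 5 p)],
      [eqAtom (r 4 p) (r 5 p)]),
    fun p => ([valAtom (r 0 p) (r 1 p) (r 3 p) (r 4 p), valAtom (r 0 p) (r 2 p) (r 3 p) (r 4 p)],
      [trueAtom (r 0 p) (Nat.pair 0 (Nat.pair (r 1 p) (r 2 p))) (r 3 p)]),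
    fun p => ([trueAtom (r 0 p) (Nat.pair 2 (r 1 p)) (r 2 p), trueAtom (r 0 p) (r 1 p) (r 2 p)],
      []),
    fun p => ([], [trueAtom (r 0 p) (Nat.pair 2 (r 1 p)) (r 2 p),
      trueAtom (r 0 p) (r 1 p) (r 2 p)]),
    fun p => ([trueAtom (r 0 p) (Nat.pair 3 (Nat.pair (r 1 p) (r 2 p))) (r 3 p)],
      [trueAtom (r 0 p) (r 1 p) (r 3 p)]),
    fun p => ([trueAtom (r 0 p) (Nat.pair 3 (Nat.pair (r 1 p) (r 2 p))) (r 3 p)],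
      [trueAtom (r 0 p) (r 2 p) (r 3 p)]),
    fun p => ([trueAtom (r 0 p) (r 1 p) (r 3 p), trueAtom (r 0 p) (r 2 p) (r 3 p)],
      [trueAtom (r 0 p) (Nat.pair 3 (Nat.pair (r 1 p) (r 2 p))) (r 3 p)]),
    fun p => ([trueAtom (r 0 p) (Nat.pair 4 (Nat.pair (r 1 p) (r 2 p))) (r 3 p)],
      [trueAtom (r 0 p) (r 2 p)
        (updateCode (r 1 p) (witnessCode (r 0 p) (r 1 p) (r 2 p) (r 3 p)) (r 3 p))]),
    fun p => ([trueAtom (r 0 p) (r 2 p) (updateCode (r 1 p) (r 4 p) (r 3 p))],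
      [trueAtom (r 0 p) (Nat.pair 4 (Nat.pair (r 1 p) (r 2 p))) (r 3 p)]),
    fun p => ([trueAtom (r 0 p) (Nat.pair 5 (Nat.pair (r 1 p) (Nat.pair (r 2 p) (r 3 p)))) (r 4 p)],
      [trueAtom (selectCode (r 0 p) (r 2 p) (r 4 p)) (r 2 p) (r 4 p)]),
    fun p => ([trueAtom (r 0 p) (Nat.pair 5 (Nat.pair (r 1 p) (Nat.pair (r 2 p) (r 3 p)))) (r 4 p)],
      [trueAtom (selectCode (r 0 p) (r 3 p) (r 4 p)) (r 3 p) (r 4 p)]),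
    fun p => ([trueAtom (r 0 p) (Nat.pair 5 (Nat.pair (r 1 p) (Nat.pair (r 2 p) (r 3 p)))) (r 4 p)],
      [geAtom (r 1 p) (selectCode (r 0 p) (r 2 p) (r 4 p)) (selectCode (r 0 p) (r 3 p) (r 4 p))]),
    fun p => ([trueAtom (selectCode (r 0 p) (r 2 p) (r 4 p)) (r 2 p) (r 4 p),
      trueAtom (selectCode (r 0 p) (r 3 p) (r 4 p)) (r 3 p) (r 4 p),
      geAtom (r 1 p) (selectCode (r 0 p) (r 2 p) (r 4 p)) (selectCode (r 0 p) (r 3 p) (r 4 p))],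
      [trueAtom (r 0 p) (Nat.pair 5 (Nat.pair (r 1 p) (Nat.pair (r 2 p) (r 3 p)))) (r 4 p)]),
    fun p => ([trueAtom (r 1 p) (r 2 p) (r 3 p)],
      [trueAtom (selectCode (r 0 p) (r 2 p) (r 3 p)) (r 2 p) (r 3 p)]),
    fun p => ([trueAtom (differCode (r 2 p) (r 3 p) (r 4 p) (r 5 p)) (r 2 p) (r 3 p),
      trueAtom (differCode (r 2 p) (r 3 p) (r 4 p) (r 5 p)) (r 4 p) (r 5 p)],
      [geAtom (r 0 p) (selectCode (r 1 p) (r 2 p) (r 3 p)) (selectCode (r 1 p) (r 4 p) (r 5 p))]),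
    fun p => ([], [trueAtom (differCode (r 2 p) (r 3 p) (r 4 p) (r 5 p)) (r 2 p) (r 3 p),
      trueAtom (differCode (r 2 p) (r 3 p) (r 4 p) (r 5 p)) (r 4 p) (r 5 p),
      geAtom (r 0 p) (selectCode (r 1 p) (r 2 p) (r 3 p)) (selectCode (r 1 p) (r 4 p) (r 5 p))]),
    fun p => ([], [geAtom (r 0 p) (r 1 p) (r 2 p), geAtom (r 0 p) (r 2 p) (r 1 p)]),
    fun p => ([geAtom (r 0 p) (r 1 p) (r 2 p), geAtom (r 0 p) (r 2 p) (r 3 p)],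
      [geAtom (r 0 p) (r 1 p) (r 3 p)])]

theorem primrec_getD_nat (i : ℕ) : Primrec fun p : List ℕ => p.getD i 0 :=
  (Primrec.list_getD 0).comp Primrec.id (Primrec.const i)

theorem primrec_describesSchemes : ∀ f ∈ describesSchemes, Primrec f := by
  simp only [describesSchemes, List.forall_mem_cons, valAtom, trueAtom, valsAtom, eqAtom, geAtom,
    updateCode, consCode, witnessCode, valueCode, selectCode, differCode]
  refine ⟨?_, ?_, ?_, ?_, ?_, ?_, ?_, ?_, ?_, ?_, ?_, ?_, ?_, ?_, ?_, ?_, ?_, ?_, ?_, ?_, ?_, ?_,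
    ?_, ?_, ?_, ?_, ?_, ?_, ?_, ?_, ?_, by simp⟩
  all_goals
    repeat' first
      | with_reducible exact Primrec.const _
      | with_reducible exact primrec_getD_nat _
      | with_reducible apply Primrec.pair
      | with_reducible apply Primrec.list_cons.comp
      | with_reducible apply Primrec₂.natPair.comp
      | with_reducible apply Primrec.succ.comp
      | with_reducible refine Primrec.ite (Primrec.eq.comp ?_ ?_) ?_ ?_

theorem describes_iff (v : List ℕ → Prop) :
    Describes v ↔ ∀ f ∈ describesSchemes, ∀ p, (f p).Holds v := by
  simp only [describesSchemes, List.forall_mem_cons, Clause.Holds]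
  constructor
  · intro h
    have hif : ∀ {q : Prop} [Decidable q] {a b : List ℕ}, v a → (¬ q → v a → v b) →
        v (if q then a else b) := by
      intro q _ a b ha hb
      split_ifs with hq
      exacts [ha, hb hq ha]
    refine ⟨?_, ?_, ?_, ?_, ?_, ?_, ?_, ?_, ?_, ?_, ?_, ?_, ?_, ?_, ?_, ?_, ?_, ?_, ?_, ?_, ?_, ?_,
      ?_, ?_, ?_, ?_, ?_, ?_, ?_, ?_, ?_, by simp⟩
    all_goals simp only [List.exists_mem_cons_iff, List.not_mem_nil,
      false_imp_iff, implies_true, and_true, false_and, exists_false, or_false, and_imp,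
      forall_true_left]
    · exact fun _ => h.var_nil _ _
    · exact fun _ => h.var_head _ _ _ _
    · exact fun _ ha => hif ha (h.var_tail _ _ _ _ _ _)
    · exact fun _ => h.val_total _ _ _
    · exact fun _ => h.val_unique _ _ _ _ _
    · exact fun _ => h.val_congr _ _ _ _ _
    · exact fun _ => h.eq_refl _
    · exact fun _ => h.eq_symm _ _
    · exact fun _ => h.eq_trans _ _ _
    · exact fun _ => h.vals_nil _ _
    · exact fun _ => h.vals_cons _ _ _ _ _ _
    · exact fun _ => h.func_congr _ _ _ _ _ _ _ _
    · exact fun _ => h.rel_congr _ _ _ _ _ _ _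
    · exact fun _ => h.equal_elim _ _ _ _ _ _
    · exact fun _ => h.equal_intro _ _ _ _ _
    · exact fun _ => h.neg_elim _ _ _
    · exact fun _ => h.neg_intro _ _ _
    · exact fun _ => h.conj_left _ _ _ _
    · exact fun _ => h.conj_right _ _ _ _
    · exact fun _ => h.conj_intro _ _ _ _
    · exact fun _ => h.ex_elim _ _ _ _
    · exact fun _ => h.ex_intro _ _ _ _ _
    · exact fun _ => h.pref_left _ _ _ _ _
    · exact fun _ => h.pref_right _ _ _ _ _
    · exact fun _ => h.pref_ge _ _ _ _ _
    · exact fun _ => h.pref_intro _ _ _ _ _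
    · exact fun _ => h.select _ _ _ _
    · exact fun _ => h.differ_pos _ _ _ _ _ _
    · exact fun _ => h.differ_neg _ _ _ _ _ _
    · exact fun _ => h.ge_total _ _ _
    · exact fun _ => h.ge_trans _ _ _ _
  · rintro ⟨h0, h1, h2, h3, h4, h5, h6, h7, h8, h9, h10, h11, h12, h13, h14, h15, h16, h17, h18,
      h19, h20, h21, h22, h23, h24, h25, h26, h27, h28, h29, h30, -⟩
    constructor
    · exact fun a b => by simpa using h0 [a, b]
    · exact fun a b c d => by simpa using h1 [a, b, c, d]
    · exact fun a b c d e f hne => by simpa [hne] using h2 [a, b, c, d, e, f]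
    · exact fun a b c => by simpa using h3 [a, b, c]
    · exact fun a b c d e => by simpa using h4 [a, b, c, d, e]
    · exact fun a b c d e => by simpa using h5 [a, b, c, d, e]
    · exact fun a => by simpa using h6 [a]
    · exact fun a b => by simpa using h7 [a, b]
    · exact fun a b c => by simpa using h8 [a, b, c]
    · exact fun a b => by simpa using h9 [a, b]
    · exact fun a b c d e f => by simpa using h10 [a, b, c, d, e, f]
    · exact fun a b c d e f g h => by simpa using h11 [a, b, c, d, e, f, g, h]
    · exact fun a b c d e f g => by simpa using h12 [a, b, c, d, e, f, g]
    · exact fun a b c d e f => by simpa using h13 [a, b, c, d, e, f]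
    · exact fun a b c d e => by simpa using h14 [a, b, c, d, e]
    · exact fun a b c => by simpa using h15 [a, b, c]
    · exact fun a b c => by simpa using h16 [a, b, c]
    · exact fun a b c d => by simpa using h17 [a, b, c, d]
    · exact fun a b c d => by simpa using h18 [a, b, c, d]
    · exact fun a b c d => by simpa using h19 [a, b, c, d]
    · exact fun a b c d => by simpa using h20 [a, b, c, d]
    · exact fun a b c d e => by simpa using h21 [a, b, c, d, e]
    · exact fun a b c d e => by simpa using h22 [a, b, c, d, e]
    · exact fun a b c d e => by simpa using h23 [a, b, c, d, e]
    · exact fun a b c d e => by simpa using h24 [a, b, c, d, e]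
    · exact fun a b c d e => by simpa using h25 [a, b, c, d, e]
    · exact fun a b c d => by simpa using h26 [a, b, c, d]
    · exact fun a b c d e f => by simpa using h27 [a, b, c, d, e, f]
    · exact fun a b c d e f => by simpa using h28 [a, b, c, d, e, f]
    · exact fun a b c => by simpa using h29 [a, b, c]
    · exact fun a b c d => by simpa using h30 [a, b, c, d]

/-- The formula coded by `c` holds in every described model. -/
def Entailed (c : ℕ) : Prop := ∀ v, Describes v → v (trueAtom 0 c 0)

theorem rePred_comp {α β : Type} [Primcodable α] [Primcodable β] {p : β → Prop} {f : α → β}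
    (hp : REPred p) (hf : Computable f) : REPred fun a => p (f a) :=
  Partrec.comp (f := fun b => Part.assert (p b) fun _ => Part.some ()) hp hf

theorem rePred_entailed_formula : REPred Entailed := by
  have h := rePred_entailed_of_schemes describesSchemes primrec_describesSchemes
  have hc : Computable fun c : ℕ => trueAtom 0 c 0 := by
    refine Primrec.to_comp ?_
    exact Primrec.list_cons.comp (Primrec.const _) (Primrec.list_cons.comp (Primrec.const _)
      (Primrec.list_cons.comp Primrec.id (Primrec.const _)))
  exact (rePred_comp h hc).of_eq fun c => by simp only [Entailed, describes_iff]

end Theory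

-- Enumerability of the set of Gödel numbers

section Codes

open Encodable Nat.Partrec

variable {σ : Signature}

/-- Clause schemes for the sets of codes of terms and formulas, where the programs `pf` and `pr`
compute the arities of function and predicate symbols, and `pi` halts on the names of indices. -/
def codeSchemes (pf pr pi : Code) : List (List ℕ → Clause (List ℕ)) :=
  let r (i : ℕ) (p : List ℕ) : ℕ := p.getD i 0
  [fun p => ([], [termAtom (Nat.pair 0 (r 0 p))]),
    fun _ => ([], [termsAtom 0 0]),
    fun p => ([termAtom (r 0 p), termsAtom (r 1 p) (r 2 p)],
      [termsAtom (consCode (r 0 p) (r 1 p)) (r 2 p).succ]),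
    -- The arity is only semicomputable from a number, so a step bound becomes a parameter: the
    -- instance is tautological until the computation halts with the right arity.
    fun p => ([termsAtom (r 0 p) (r 1 p)], [if Code.evaln (r 3 p) pf (r 2 p) = some (r 1 p)
      then termAtom (Nat.pair 1 (Nat.pair (r 2 p) (r 0 p))) else termsAtom (r 0 p) (r 1 p)]),
    fun p => ([termAtom (r 0 p), termAtom (r 1 p)],
      [formulaAtom (Nat.pair 0 (Nat.pair (r 0 p) (r 1 p)))]),
    fun p => ([termsAtom (r 0 p) (r 1 p)], [if Code.evaln (r 3 p) pr (r 2 p) = some (r 1 p)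
      then formulaAtom (Nat.pair 1 (Nat.pair (r 2 p) (r 0 p))) else termsAtom (r 0 p) (r 1 p)]),
    fun p => ([formulaAtom (r 0 p)], [formulaAtom (Nat.pair 2 (r 0 p))]),
    fun p => ([formulaAtom (r 0 p), formulaAtom (r 1 p)],
      [formulaAtom (Nat.pair 3 (Nat.pair (r 0 p) (r 1 p)))]),
    fun p => ([formulaAtom (r 0 p)], [formulaAtom (Nat.pair 4 (Nat.pair (r 1 p) (r 0 p)))]),
    fun p => ([formulaAtom (r 0 p), formulaAtom (r 1 p)],
      [if Code.evaln (r 3 p) pi (r 2 p) = some 0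
        then formulaAtom (Nat.pair 5 (Nat.pair (r 2 p) (Nat.pair (r 0 p) (r 1 p))))
        else formulaAtom (r 0 p)])]

theorem primrec_codeSchemes (pf pr pi : Code) : ∀ f ∈ codeSchemes pf pr pi, Primrec f := by
  have heval : ∀ (c : Code) (i j : ℕ),
      Primrec fun p : List ℕ => Code.evaln (p.getD i 0) c (p.getD j 0) := fun c i j =>
    Code.primrec_evaln.comp (((primrec_getD_nat i).pair (Primrec.const c)).pair
      (primrec_getD_nat j))
  simp only [codeSchemes, List.forall_mem_cons, termAtom, termsAtom, formulaAtom, consCode]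
  refine ⟨?_, ?_, ?_, ?_, ?_, ?_, ?_, ?_, ?_, ?_, by simp⟩
  all_goals
    repeat' first
      | with_reducible exact Primrec.const _
      | with_reducible exact primrec_getD_nat _
      | with_reducible exact heval _ _ _
      | with_reducible apply Primrec.pair
      | with_reducible apply Primrec.list_cons.comp
      | with_reducible apply Primrec₂.natPair.comp
      | with_reducible apply Primrec.succ.comp
      | with_reducible apply Primrec.option_some.comp
      | with_reducible refine Primrec.ite (Primrec.eq.comp ?_ ?_) ?_ ?_

theorem exists_program {f : ℕ →. ℕ} (hf : Partrec f) :
    ∃ p : Code, ∀ k n, (∃ s, Code.evaln s p k = some n) ↔ n ∈ f k := by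
  obtain ⟨p, hp⟩ := Code.exists_code.1 (Partrec.nat_iff.1 hf)
  exact ⟨p, fun k n => by rw [← hp, Code.evaln_complete]; rfl⟩

theorem encode_list_ofFn_succ {n : ℕ} (c : Fin (n + 1) → ℕ) :
    encode (List.ofFn c) = consCode (c 0) (encode (List.ofFn fun i => c i.succ)) := by
  rw [List.ofFn_succ, encode_list_cons]
  rfl

/-- The set of codes of terms, of lists of terms and of formulas, as a valuation. -/
def codeValuation (ν : EffectiveEnumeration σ) : List ℕ → Prop
  | [0, t] => ∃ τ, TermCode ν t τ
  | [1, l, n] => ∃ (c : Fin n → ℕ) (ts : Fin n → σ.Term),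
      l = encode (List.ofFn c) ∧ ∀ i, TermCode ν (c i) (ts i)
  | [2, c] => ∃ φ, FormulaCode ν c φ
  | _ => True

/-- The formation rules are Horn clauses. The actual sets of codes satisfy them, and induction on
codes shows that every satisfying valuation contains these sets, so being a code is the same as
being entailed. -/
theorem rePred_formulaCode (ν : EffectiveEnumeration σ) :
    REPred fun c => ∃ φ, FormulaCode ν c φ := by
  obtain ⟨pf, hpf⟩ := exists_program ν.func_arity
  obtain ⟨pr, hpr⟩ := exists_program ν.rel_arity
  -- Index names carry no arity; the semidecision procedure is made to output `0` on halting.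
  obtain ⟨pi, hpi⟩ := exists_program
    (Partrec.map (f := fun k => Part.assert _ fun _ => Part.some ()) (g := fun _ _ => 0)
      ν.index_re (Computable.const 0).to₂)
  simp only [Part.mem_ofOption, Option.mem_def] at hpf hpr
  replace hpi : ∀ k, (∃ s, Code.evaln s pi k = some 0) ↔ (ν.index k).isSome = true := by
    intro k; rw [hpi]; simp
  have hc : Computable formulaAtom := by
    refine Primrec.to_comp ?_
    exact Primrec.list_cons.comp (Primrec.const _)
      (Primrec.list_cons.comp Primrec.id (Primrec.const _))
  refine (rePred_comp (rePred_entailed_of_schemes _ (primrec_codeSchemes pf pr pi)) hc).of_eq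
    fun c => ⟨fun h => ?_, ?_⟩
  · refine h (codeValuation ν) ?_
    have hif : ∀ {q : Prop} [Decidable q] {a b : List ℕ}, codeValuation ν b →
        (q → codeValuation ν a) → codeValuation ν (if q then a else b) := by
      intro q _ a b ha hb
      split_ifs with hq
      exacts [hb hq, ha]
    simp only [codeSchemes, List.forall_mem_cons, Clause.Holds]
    refine ⟨?_, ?_, ?_, ?_, ?_, ?_, ?_, ?_, ?_, ?_, by simp⟩
    all_goals simp only [List.exists_mem_cons_iff, List.not_mem_nil,
      false_imp_iff, implies_true, and_true, false_and, exists_false, or_false, and_imp,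
      forall_true_left]
    · exact fun _ => ⟨_, TermCode.var _⟩
    · exact fun _ => ⟨Fin.elim0, Fin.elim0, rfl, fun i => i.elim0⟩
    · rintro p ⟨τ, hτ⟩ ⟨c, ts, hl, hts⟩
      refine ⟨Fin.cons (p.getD 0 0) c, Fin.cons τ ts, ?_, fun i => ?_⟩
      · rw [encode_list_ofFn_succ, hl]
        simp
      · refine Fin.cases ?_ (fun i => ?_) i
        · exact hτ
        · exact hts i
    · intro p hp
      refine hif hp fun hq => ?_
      obtain ⟨c, ts, hl, hts⟩ := hp
      obtain ⟨⟨n, f⟩, hf, hn⟩ := Option.map_eq_some_iff.1 ((hpf _ _).1 ⟨_, hq⟩)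
      generalize p.getD 1 0 = m at *
      subst hn
      rw [hl]
      exact ⟨_, TermCode.func hf hts⟩
    · rintro p ⟨τ, hτ⟩ ⟨τ', hτ'⟩
      exact ⟨_, FormulaCode.equal hτ hτ'⟩
    · intro p hp
      refine hif hp fun hq => ?_
      obtain ⟨c, ts, hl, hts⟩ := hp
      obtain ⟨⟨n, f⟩, hf, hn⟩ := Option.map_eq_some_iff.1 ((hpr _ _).1 ⟨_, hq⟩)
      generalize p.getD 1 0 = m at *
      subst hn
      rw [hl]
      exact ⟨_, FormulaCode.rel hf hts⟩
    · rintro p ⟨φ, hφ⟩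
      exact ⟨_, hφ.neg⟩
    · rintro p ⟨φ, hφ⟩ ⟨ψ, hψ⟩
      exact ⟨_, hφ.conj hψ⟩
    · rintro p ⟨φ, hφ⟩
      exact ⟨_, hφ.ex _⟩
    · intro p hφ hψ
      refine hif hφ fun hq => ?_
      obtain ⟨φ, hφ⟩ := hφ
      obtain ⟨ψ, hψ⟩ := hψ
      obtain ⟨X, hX⟩ := Option.isSome_iff_exists.1 ((hpi _).1 ⟨_, hq⟩)
      exact ⟨_, FormulaCode.pref hX hφ hψ⟩
  · rintro ⟨φ, hφ⟩ v hv
    simp only [codeSchemes, List.forall_mem_cons, Clause.Holds] at hv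
    obtain ⟨h0, h1, h2, h3, h4, h5, h6, h7, h8, h9, -⟩ := hv
    have hnil : v (termsAtom 0 0) := by simpa using h1 []
    have hcons : ∀ t l n, v (termAtom t) → v (termsAtom l n) →
        v (termsAtom (consCode t l) (n + 1)) := fun t l n => by simpa using h2 [t, l, n]
    have hterms : ∀ n (c : Fin n → ℕ), (∀ i, v (termAtom (c i))) →
        v (termsAtom (encode (List.ofFn c)) n) := by
      intro n
      induction n with
      | zero => exact fun c _ => by simpa using hnil
      | succ n ih =>
        intro c hc
        rw [encode_list_ofFn_succ]
        exact hcons _ _ _ (hc 0) (ih _ fun i => hc i.succ)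
    have hterm : ∀ t τ, TermCode ν t τ → v (termAtom t) := by
      intro t τ h
      induction h with
      | var x => simpa using h0 [x]
      | @func n k f c ts hk _ ih =>
        obtain ⟨s, hs⟩ := (hpf k n).2 (by simp [hk])
        simpa [hs] using h3 [encode (List.ofFn c), n, k, s] (by simpa using hterms _ c ih)
    induction hφ with
    | @equal a b _ _ ha hb =>
      simpa using h4 [a, b] (by simpa using ⟨hterm _ _ ha, hterm _ _ hb⟩)
    | @rel n k R c ts hk hts =>
      obtain ⟨s, hs⟩ := (hpr k n).2 (by simp [hk])
      simpa [hs] using h5 [encode (List.ofFn c), n, k, s]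
        (by simpa using hterms _ c fun i => hterm _ _ (hts i))
    | @neg a _ _ ih => simpa using h6 [a] (by simpa using ih)
    | @conj a b _ _ _ _ iha ihb => simpa using h7 [a, b] (by simpa using ⟨iha, ihb⟩)
    | @ex a x _ _ ih => simpa using h8 [a, x] (by simpa using ih)
    | @pref k a b X _ _ hk _ _ iha ihb =>
      obtain ⟨s, hs⟩ := (hpi k).2 (by simp [hk])
      simpa [hs] using h9 [a, b, k, s] (by simpa using ⟨iha, ihb⟩)

end Codes

-- Interpreting names in a given model

section Interpretation

/-- A nonzero tag is what makes recursion on codes well-founded: `Nat.pair 0 0 = 0` and `Nat.pair 0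
1 = 1` show that tag `0` does not decrease strictly. -/
theorem pair_snd_lt {n : ℕ} (h : n.unpair.1 ≠ 0) : n.unpair.2 < n := by
  conv_rhs => rw [← Nat.pair_unpair n]
  unfold Nat.pair
  split_ifs with hlt
  · have := Nat.le_mul_self n.unpair.2
    have := Nat.pos_of_ne_zero h
    omega
  · nlinarith [Nat.pos_of_ne_zero h]

/-- The assignment coded by an environment, where `d` is the assignment coded by the empty
environment and `i a` is the individual coded by `a`. -/
def decodeEnv {D : Type u} (d i : ℕ → D) : ℕ → ℕ → D
  | 0 => d
  | e + 1 => Function.update (decodeEnv d i e.unpair.2) e.unpair.1.unpair.1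
      (i e.unpair.1.unpair.2)
  decreasing_by exact Nat.lt_succ_of_le (Nat.unpair_right_le _)

theorem decodeEnv_zero {D : Type u} (d i : ℕ → D) : decodeEnv d i 0 = d := by
  rw [decodeEnv]

theorem decodeEnv_updateCode {D : Type u} (d i : ℕ → D) (x a e : ℕ) :
    decodeEnv d i (updateCode x a e) = Function.update (decodeEnv d i e) x (i a) := by
  rw [updateCode, consCode, decodeEnv]
  simp

theorem decodeEnv_congr {D : Type u} (d : ℕ → D) {i j : ℕ → D} {e : ℕ}
    (h : ∀ a < e, i a = j a) : decodeEnv d i e = decodeEnv d j e := by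
  induction e using Nat.strong_induction_on with
  | _ e ih =>
    cases e with
    | zero => rw [decodeEnv, decodeEnv]
    | succ e =>
      have h1 := Nat.lt_succ_of_le (Nat.unpair_right_le e)
      have h2 := Nat.lt_succ_of_le
        ((Nat.unpair_right_le e.unpair.1).trans (Nat.unpair_left_le e))
      rw [decodeEnv, decodeEnv, ih _ h1 fun a ha => h a (ha.trans h1), h _ h2]

/-- Course-of-values recursion in a form where the step `Φ` receives a total function, padded by
`a`, so that it can be applied to whole environments. -/
theorem exists_eq_of_truncation {α : Type u} (a : α) (Φ : ℕ → (ℕ → α) → α) :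
    ∃ f : ℕ → α, ∀ n, f n = Φ n fun m => if m < n then f m else a := by
  refine ⟨Nat.lt_wfRel.wf.fix fun n f => Φ n fun m => if h : m < n then f m h else a, fun n => ?_⟩
  rw [WellFounded.fix_eq]
  congr 1

/-- Individuals and worlds can be assigned to their codes as intended. -/
theorem exists_interpretation {D : Type u} {W : Type v} (d : ℕ → D) (w₀ : W)
    (F : ℕ → (ℕ → D) → Set W) (V : W → (ℕ → D) → ℕ → D) (s : W → Set W → W) :
    ∃ (i : ℕ → D) (j : ℕ → W), (∀ x, i (Nat.pair 0 x) = d x) ∧ j 0 = w₀ ∧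
      (∀ w x c e, (∃ a, j w ∈ F c (Function.update (decodeEnv d i e) x a)) →
        j w ∈ F c (Function.update (decodeEnv d i e) x (i (witnessCode w x c e)))) ∧
      (∀ w t e, i (valueCode w t e) = V (j w) (decodeEnv d i e) t) ∧
      (∀ w c e, j (selectCode w c e) = s (j w) (F c (decodeEnv d i e))) ∧
      ∀ c e c' e', F c (decodeEnv d i e) ≠ F c' (decodeEnv d i e') →
        ¬ (j (differCode c e c' e') ∈ F c (decodeEnv d i e) ↔
          j (differCode c e c' e') ∈ F c' (decodeEnv d i e')) := by
  classical
  have : Nonempty D := ⟨d 0⟩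
  have : Nonempty W := ⟨w₀⟩
  -- Individuals and worlds must be interpreted simultaneously: witnesses and term values depend on
  -- worlds, while selected and differing worlds depend on the individuals in environments. All
  -- names involved are smaller numbers.
  let Φ (n : ℕ) (f : ℕ → D × W) : D × W :=
    let i a := (f a).1
    let p := n.unpair.2
    (if n.unpair.1 = 0 then d p
      else if n.unpair.1 = 1 then
        Classical.epsilon fun a => (f p.unpair.1).2 ∈ F p.unpair.2.unpair.2.unpair.1
          (Function.update (decodeEnv d i p.unpair.2.unpair.2.unpair.2) p.unpair.2.unpair.1 a)
      else V (f p.unpair.1).2 (decodeEnv d i p.unpair.2.unpair.2) p.unpair.2.unpair.1,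
     if n.unpair.1 = 0 then w₀
      else if n.unpair.1 = 1 then s (f p.unpair.1).2
        (F p.unpair.2.unpair.1 (decodeEnv d i p.unpair.2.unpair.2))
      else Classical.epsilon fun u =>
        ¬ (u ∈ F p.unpair.1.unpair.1 (decodeEnv d i p.unpair.1.unpair.2) ↔
          u ∈ F p.unpair.2.unpair.1 (decodeEnv d i p.unpair.2.unpair.2)))
  obtain ⟨f, hf⟩ := exists_eq_of_truncation (d 0, w₀) Φ
  have htrunc : ∀ {n a : ℕ}, a < n → (if a < n then f a else (d 0, w₀)) = f a :=
    fun h => if_pos h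
  have henv : ∀ {n e : ℕ}, e < n →
      decodeEnv d (fun a => (if a < n then f a else (d 0, w₀)).1) e =
        decodeEnv d (fun a => (f a).1) e :=
    fun h => decodeEnv_congr d fun a ha => by rw [if_pos (ha.trans h)]
  have hlt : ∀ {a n : ℕ} (k : ℕ), k ≠ 0 → a ≤ n → a < Nat.pair k n := fun {a n} k hk h =>
    lt_of_le_of_lt h (by simpa using pair_snd_lt (n := Nat.pair k n) (by simpa using hk))
  have hl := Nat.left_le_pair
  have hr := Nat.right_le_pair
  refine ⟨fun a => (f a).1, fun a => (f a).2, fun x => ?_, ?_, fun w x c e h => ?_,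
    fun w t e => ?_, fun w c e => ?_, fun c e c' e' h => ?_⟩
  · simp only [hf (Nat.pair 0 x), Φ, Nat.unpair_pair, if_true]
  · simp only [hf 0, Φ]
    exact if_pos (by simp)
  · have h1 : w < witnessCode w x c e := hlt 1 one_ne_zero (hl _ _)
    have h2 : e < witnessCode w x c e :=
      hlt 1 one_ne_zero ((hr _ _).trans ((hr _ _).trans (hr _ _)))
    have h3 : (f (witnessCode w x c e)).1 = Classical.epsilon fun a => (f w).2 ∈ F c
        (Function.update (decodeEnv d (fun a => (f a).1) e) x a) := by
      rw [hf (witnessCode w x c e)]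
      simp only [Φ]
      simp only [witnessCode, Nat.unpair_pair, one_ne_zero, if_false, if_true]
      simp only [← witnessCode.eq_def, htrunc h1, henv h2]
    simp only [h3]
    exact Classical.epsilon_spec h
  · have h1 : w < valueCode w t e := hlt 2 two_ne_zero (hl _ _)
    have h2 : e < valueCode w t e := hlt 2 two_ne_zero ((hr _ _).trans (hr _ _))
    simp only [hf (valueCode w t e), Φ]
    simp only [valueCode, Nat.unpair_pair, two_ne_zero, if_false, OfNat.ofNat_ne_one]
    simp only [← valueCode.eq_def, htrunc h1, henv h2]
  · have h1 : w < selectCode w c e := hlt 1 one_ne_zero (hl _ _)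
    have h2 : e < selectCode w c e := hlt 1 one_ne_zero ((hr _ _).trans (hr _ _))
    simp only [hf (selectCode w c e), Φ]
    simp only [selectCode, Nat.unpair_pair, one_ne_zero, if_false, if_true]
    simp only [← selectCode.eq_def, htrunc h1, henv h2]
  · have h1 : e < differCode c e c' e' := hlt 2 two_ne_zero ((hr _ _).trans (hl _ _))
    have h2 : e' < differCode c e c' e' := hlt 2 two_ne_zero ((hr _ _).trans (hr _ _))
    have h3 : (f (differCode c e c' e')).2 = Classical.epsilon fun u =>
        ¬ (u ∈ F c (decodeEnv d (fun a => (f a).1) e) ↔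
          u ∈ F c' (decodeEnv d (fun a => (f a).1) e')) := by
      rw [hf (differCode c e c' e')]
      simp only [Φ]
      simp only [differCode, Nat.unpair_pair, two_ne_zero, if_false, OfNat.ofNat_ne_one]
      simp only [← differCode.eq_def, henv h1, henv h2]
    simp only [h3]
    refine Classical.epsilon_spec (p := fun u =>
        ¬ (u ∈ F c (decodeEnv d (fun a => (f a).1) e) ↔
          u ∈ F c' (decodeEnv d (fun a => (f a).1) e'))) ?_
    by_contra! hcon
    exact h (Set.ext hcon)

end Interpretation

-- Semantics evaluated directly on numbers

section Evaluation

open Encodable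

variable {σ : Signature} (ν : EffectiveEnumeration σ) (M : Core.{u, v} σ)

/-- The relation named by `k` at the world `w`. -/
def Core.relNamed (k : ℕ) (w : M.W) (xs : List M.D) : Prop :=
  ∃ (n : ℕ) (R : σ.L.Relations n) (x : Fin n → M.D),
    ν.rel k = some ⟨n, R⟩ ∧ xs = List.ofFn x ∧ (M.t w).RelMap R x

/-- The function named by `k` at the world `w`. -/
noncomputable def Core.funcNamed (k : ℕ) (w : M.W) (xs : List M.D) : M.D :=
  haveI := M.D_nonempty
  -- Clauses range over all numbers, not only codes. For a non-name or a wrong number of arguments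
  -- the value is arbitrary but still determined by the values of the arguments, as `func_congr`
  -- demands.
  Classical.epsilon fun a => ∃ (n : ℕ) (f : σ.L.Functions n) (x : Fin n → M.D),
    ν.func k = some ⟨n, f⟩ ∧ xs = List.ofFn x ∧ a = (M.t w).funMap f x

mutual

/-- The value of the term coded by a number. -/
noncomputable def Core.valueOfTerm (w : M.W) (d : ℕ → M.D) (t : ℕ) : M.D :=
  if _h : t.unpair.1 = 0 then d t.unpair.2
  else Core.funcNamed ν M t.unpair.2.unpair.1 w (Core.valueOfTerms w d t.unpair.2.unpair.2)
  termination_by t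
  decreasing_by exact (Nat.unpair_right_le _).trans_lt (pair_snd_lt ‹_›)

/-- The values of the terms of the list coded by a number. -/
noncomputable def Core.valueOfTerms (w : M.W) (d : ℕ → M.D) (l : ℕ) : List M.D :=
  match l with
  | 0 => []
  | l + 1 => Core.valueOfTerm w d l.unpair.1 :: Core.valueOfTerms w d l.unpair.2
  termination_by l
  decreasing_by
    · exact Nat.lt_succ_of_le (Nat.unpair_left_le _)
    · exact Nat.lt_succ_of_le (Nat.unpair_right_le _)

end

/-- The proposition expressed by the formula coded by a number. -/
noncomputable def Core.valueOfFormula (ge : ℕ → M.W → M.W → Prop) (c : ℕ) (d : ℕ → M.D) : Set M.W :=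
  let p := c.unpair.2
  if _ : c.unpair.1 = 0 then {w | M.valueOfTerm ν w d p.unpair.1 = M.valueOfTerm ν w d p.unpair.2}
  else if c.unpair.1 = 1 then {w | M.relNamed ν p.unpair.1 w (M.valueOfTerms ν w d p.unpair.2)}
  else if c.unpair.1 = 2 then (Core.valueOfFormula ge p d)ᶜ
  else if c.unpair.1 = 3 then Core.valueOfFormula ge p.unpair.1 d ∩ Core.valueOfFormula ge p.unpair.2 d
  else if c.unpair.1 = 4 then
    {w | ∃ a : M.D, w ∈ Core.valueOfFormula ge p.unpair.2 (Function.update d p.unpair.1 a)}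
  else {w | ∃ (hφ : (Core.valueOfFormula ge p.unpair.2.unpair.1 d).Nonempty)
      (hψ : (Core.valueOfFormula ge p.unpair.2.unpair.2 d).Nonempty),
    ge p.unpair.1 (M.s w ⟨_, hφ⟩) (M.s w ⟨_, hψ⟩)}
  termination_by c
  decreasing_by
    all_goals
      have := pair_snd_lt (n := c) ‹_›
      have := Nat.unpair_left_le c.unpair.2
      have := Nat.unpair_right_le c.unpair.2
      have := Nat.unpair_left_le c.unpair.2.unpair.2
      have := Nat.unpair_right_le c.unpair.2.unpair.2
      omega

end Evaluation

-- Soundness: every preorder model gives a describing valuation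

section Soundness

open Encodable

variable {σ : Signature} (ν : EffectiveEnumeration σ) (M : Core.{u, v} σ)

theorem Core.valueOfTerm_var (w : M.W) (d : ℕ → M.D) (x : ℕ) :
    M.valueOfTerm ν w d (Nat.pair 0 x) = d x := by
  rw [Core.valueOfTerm]; simp

theorem Core.valueOfTerm_func (w : M.W) (d : ℕ → M.D) (k l : ℕ) :
    M.valueOfTerm ν w d (Nat.pair 1 (Nat.pair k l)) =
      M.funcNamed ν k w (M.valueOfTerms ν w d l) := by
  rw [Core.valueOfTerm]; simp

theorem Core.valueOfTerms_zero (w : M.W) (d : ℕ → M.D) : M.valueOfTerms ν w d 0 = [] := by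
  rw [Core.valueOfTerms]

theorem Core.valueOfTerms_consCode (w : M.W) (d : ℕ → M.D) (t l : ℕ) :
    M.valueOfTerms ν w d (consCode t l) = M.valueOfTerm ν w d t :: M.valueOfTerms ν w d l := by
  rw [consCode, Core.valueOfTerms]; simp

variable (ge : ℕ → M.W → M.W → Prop)

theorem Core.valueOfFormula_equal (s t : ℕ) (d : ℕ → M.D) :
    M.valueOfFormula ν ge (Nat.pair 0 (Nat.pair s t)) d =
      {w | M.valueOfTerm ν w d s = M.valueOfTerm ν w d t} := by
  rw [Core.valueOfFormula]; simp

theorem Core.valueOfFormula_rel (k l : ℕ) (d : ℕ → M.D) :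
    M.valueOfFormula ν ge (Nat.pair 1 (Nat.pair k l)) d =
      {w | M.relNamed ν k w (M.valueOfTerms ν w d l)} := by
  rw [Core.valueOfFormula]; simp

theorem Core.valueOfFormula_neg (c : ℕ) (d : ℕ → M.D) :
    M.valueOfFormula ν ge (Nat.pair 2 c) d = (M.valueOfFormula ν ge c d)ᶜ := by
  rw [Core.valueOfFormula]; simp

theorem Core.valueOfFormula_conj (c c' : ℕ) (d : ℕ → M.D) :
    M.valueOfFormula ν ge (Nat.pair 3 (Nat.pair c c')) d =
      M.valueOfFormula ν ge c d ∩ M.valueOfFormula ν ge c' d := by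
  rw [Core.valueOfFormula]; simp

theorem Core.valueOfFormula_ex (x c : ℕ) (d : ℕ → M.D) :
    M.valueOfFormula ν ge (Nat.pair 4 (Nat.pair x c)) d =
      {w | ∃ a : M.D, w ∈ M.valueOfFormula ν ge c (Function.update d x a)} := by
  rw [Core.valueOfFormula]; simp

theorem Core.valueOfFormula_pref (k c c' : ℕ) (d : ℕ → M.D) :
    M.valueOfFormula ν ge (Nat.pair 5 (Nat.pair k (Nat.pair c c'))) d =
      {w | ∃ (hφ : (M.valueOfFormula ν ge c d).Nonempty) (hψ : (M.valueOfFormula ν ge c' d).Nonempty),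
        ge k (M.s w ⟨_, hφ⟩) (M.s w ⟨_, hψ⟩)} := by
  rw [Core.valueOfFormula]; simp

theorem Core.valueOfTerms_ofFn (w : M.W) (d : ℕ → M.D) {n : ℕ} (c : Fin n → ℕ) :
    M.valueOfTerms ν w d (encode (List.ofFn c)) = List.ofFn fun i => M.valueOfTerm ν w d (c i) := by
  induction n with
  | zero => simpa using M.valueOfTerms_zero ν w d
  | succ n ih => rw [encode_list_ofFn_succ, Core.valueOfTerms_consCode, ih, List.ofFn_succ]

theorem sigma_ofFn_inj {α : Type*} {D : Type*} {β : ℕ → Type*} {n m : ℕ} {a : β n} {b : β m}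
    {x : Fin n → D} {y : Fin m → D} (h : (⟨n, a⟩ : Σ n, β n) = ⟨m, b⟩)
    (hxy : List.ofFn x = List.ofFn y) (P : ∀ n, β n → (Fin n → D) → α) :
    P n a x = P m b y := by
  obtain ⟨rfl, h⟩ := Sigma.mk.inj_iff.1 h
  rw [eq_of_heq h, List.ofFn_injective hxy]

theorem Core.relNamed_iff {n k : ℕ} {R : σ.L.Relations n} (hk : ν.rel k = some ⟨n, R⟩) (w : M.W)
    (x : Fin n → M.D) : M.relNamed ν k w (List.ofFn x) ↔ (M.t w).RelMap R x := by
  refine ⟨?_, fun h => ⟨n, R, x, hk, rfl, h⟩⟩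
  rintro ⟨m, S, y, hS, hxy, h⟩
  rw [hk, Option.some_inj] at hS
  exact (sigma_ofFn_inj hS hxy fun n R x => (M.t w).RelMap R x).mpr h

theorem Core.funcNamed_eq {n k : ℕ} {f : σ.L.Functions n} (hk : ν.func k = some ⟨n, f⟩) (w : M.W)
    (x : Fin n → M.D) : M.funcNamed ν k w (List.ofFn x) = (M.t w).funMap f x := by
  have := M.D_nonempty
  obtain ⟨m, g, y, hg, hxy, h⟩ := Classical.epsilon_spec
    (p := fun a => ∃ (m : ℕ) (g : σ.L.Functions m) (y : Fin m → M.D),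
      ν.func k = some ⟨m, g⟩ ∧ List.ofFn x = List.ofFn y ∧ a = (M.t w).funMap g y)
    ⟨_, n, f, x, hk, rfl, rfl⟩
  rw [hk, Option.some_inj] at hg
  exact h.trans (sigma_ofFn_inj hg hxy fun n f x => (M.t w).funMap f x).symm

theorem Core.valueOfTerm_eq {c : ℕ} {τ : σ.Term} (h : TermCode ν c τ) (w : M.W) (d : ℕ → M.D) :
    M.valueOfTerm ν w d c = M.termVal w d τ := by
  induction h with
  | var x => exact M.valueOfTerm_var ν w d x
  | func hk _ ih =>
    rw [Core.valueOfTerm_func, Core.valueOfTerms_ofFn, Core.funcNamed_eq ν M hk]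
    simp only [ih]
    rfl

theorem Core.valueOfFormula_eq {ge : ℕ → M.W → M.W → Prop} {ge' : σ.U → M.W → M.W → Prop}
    (hge : ∀ k X, ν.index k = some X → ge k = ge' X) {c : ℕ} {φ : Formula σ}
    (h : FormulaCode ν c φ) (d : ℕ → M.D) : M.valueOfFormula ν ge c d = M.prop ge' φ d := by
  induction h generalizing d with
  | equal ha hb =>
    rw [Core.valueOfFormula_equal]
    simp only [Core.valueOfTerm_eq ν M ha, Core.valueOfTerm_eq ν M hb]
    rfl
  | rel hk hc =>
    rw [Core.valueOfFormula_rel]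
    simp only [Core.valueOfTerms_ofFn, Core.relNamed_iff ν M hk, Core.valueOfTerm_eq ν M (hc _)]
    rfl
  | neg _ ih => rw [Core.valueOfFormula_neg, ih]; rfl
  | conj _ _ iha ihb => rw [Core.valueOfFormula_conj, iha, ihb]; rfl
  | ex x _ ih => rw [Core.valueOfFormula_ex]; simp only [ih]; rfl
  | pref hk _ _ iha ihb =>
    rw [Core.valueOfFormula_pref]
    simp only [iha, ihb, hge _ _ hk]
    rfl

/-- The individuals coded by a list of numbers. -/
def decodeNames {D : Type u} (i : ℕ → D) : ℕ → List D
  | 0 => []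
  | b + 1 => i b.unpair.1 :: decodeNames i b.unpair.2
  decreasing_by exact Nat.lt_succ_of_le (Nat.unpair_right_le _)

theorem decodeNames_zero {D : Type u} (i : ℕ → D) : decodeNames i 0 = [] := by
  rw [decodeNames]

theorem decodeNames_consCode {D : Type u} (i : ℕ → D) (a b : ℕ) :
    decodeNames i (consCode a b) = i a :: decodeNames i b := by
  rw [consCode, decodeNames]; simp

/-- The valuation given by a model with an interpretation of codes of individuals and worlds. -/
def Core.valuation (d i : ℕ → M.D) (j : ℕ → M.W) : List ℕ → Prop
  | [0, w, c, e] => j w ∈ M.valueOfFormula ν ge c (decodeEnv d i e)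
  | [1, w, t, e, a] => M.valueOfTerm ν (j w) (decodeEnv d i e) t = i a
  | [2, w, l, e, b] => M.valueOfTerms ν (j w) (decodeEnv d i e) l = decodeNames i b
  | [3, a, b] => i a = i b
  | [4, k, w, w'] => ge k (j w) (j w')
  | _ => True

/-- With names interpreted as intended, each clause is a semantic fact. Reflexivity of `ge` handles
the differing-world clauses: equal propositions select the same world, and unequal ones are
separated at the differing world. -/
theorem Core.exists_describes (hrefl : ∀ k w, ge k w w)
    (htrans : ∀ k w w' w'', ge k w w' → ge k w' w'' → ge k w w'')
    (htotal : ∀ k w w', ge k w w' ∨ ge k w' w) (d : ℕ → M.D) (w₀ : M.W) :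
    ∃ v, Describes v ∧ ∀ c, v (trueAtom 0 c 0) ↔ w₀ ∈ M.valueOfFormula ν ge c d := by
  classical
  obtain ⟨i, j, hdef, hj0, hwit, hval, hsel, hdif⟩ := exists_interpretation d w₀
    (M.valueOfFormula ν ge) (M.valueOfTerm ν) fun w A => if h : A.Nonempty then M.s w ⟨A, h⟩ else w
  have hsel' : ∀ w c e (h : (M.valueOfFormula ν ge c (decodeEnv d i e)).Nonempty),
      j (selectCode w c e) = M.s (j w) ⟨_, h⟩ := fun w c e h => by rw [hsel, dif_pos h]
  have hselmem : ∀ w c e, (M.valueOfFormula ν ge c (decodeEnv d i e)).Nonempty →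
      j (selectCode w c e) ∈ M.valueOfFormula ν ge c (decodeEnv d i e) := fun w c e h => by
    rw [hsel' w c e h]; exact M.s_mem (j w) ⟨_, h⟩
  have hge : ∀ k w c e c' e',
      M.valueOfFormula ν ge c (decodeEnv d i e) = M.valueOfFormula ν ge c' (decodeEnv d i e') →
        ge k (j (selectCode w c e)) (j (selectCode w c' e')) := fun k w c e c' e' h => by
    rw [hsel, hsel, h]; exact hrefl _ _
  refine ⟨M.valuation ν ge d i j, ?_, fun c => ?_⟩
  swap
  · simp only [trueAtom, Core.valuation, decodeEnv_zero, hj0]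
  constructor <;> simp only [trueAtom, valAtom, valsAtom, eqAtom, geAtom, Core.valuation,
    decodeEnv_updateCode, decodeEnv_zero, Core.valueOfTerm_var, Core.valueOfTerms_zero,
    Core.valueOfTerms_consCode, decodeNames_zero, decodeNames_consCode, Core.valueOfTerm_func,
    Core.valueOfFormula_equal, Core.valueOfFormula_rel, Core.valueOfFormula_neg, Core.valueOfFormula_conj,
    Core.valueOfFormula_ex, Core.valueOfFormula_pref, Set.mem_ofPred_eq, Set.mem_compl_iff,
    Set.mem_inter_iff, Function.update_self]
  case var_nil => exact fun w x => (hdef x).symm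
  case var_head => simp
  case var_tail => exact fun w x a e y b hxy h => by rw [Function.update_of_ne hxy.symm, h]
  case val_total => exact fun w t e => (hval w t e).symm
  case val_unique => exact fun w t e a b h h' => h.symm.trans h'
  case val_congr => exact fun w t e a b h h' => h.trans h'
  case eq_refl => simp
  case eq_symm => exact fun a b h => h.symm
  case eq_trans => exact fun a b c h h' => h.trans h'
  case vals_nil => simp
  case vals_cons => exact fun w t l e a b h h' => by rw [h, h']
  case func_congr => exact fun w k l e l' e' a b h h' h'' => by rwa [h', ← h]
  case rel_congr => exact fun w k l e l' e' b h h' h'' => by rwa [h', ← h]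
  case equal_elim => exact fun w s t e a b h hs ht => by rw [← hs, h, ht]
  case equal_intro => exact fun w s t e a hs ht => hs.trans ht.symm
  case neg_elim => exact fun w c e h => h
  case neg_intro => exact fun w c e => (em _).symm
  case conj_left => exact fun w c c' e h => h.1
  case conj_right => exact fun w c c' e h => h.2
  case conj_intro => exact fun w c c' e h h' => ⟨h, h'⟩
  case ex_elim => exact fun w x c e h => hwit w x c e h
  case ex_intro => exact fun w x c e a h => ⟨_, h⟩
  case pref_left => exact fun w k c c' e h => hselmem _ _ _ h.1
  case pref_right => exact fun w k c c' e h => hselmem _ _ _ h.2.1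
  case pref_ge =>
    rintro w k c c' e ⟨h, h', hk⟩
    rwa [hsel' w c e h, hsel' w c' e h']
  case pref_intro =>
    intro w k c c' e h h' hk
    refine ⟨⟨_, h⟩, ⟨_, h'⟩, ?_⟩
    rwa [hsel' w c e ⟨_, h⟩, hsel' w c' e ⟨_, h'⟩] at hk
  case select => exact fun w w' c e h => hselmem _ _ _ ⟨_, h⟩
  case differ_pos =>
    intro k w c e c' e' h h'
    refine hge _ _ _ _ _ _ (by_contra fun hne => hdif c e c' e' hne ?_)
    simp only [h, h']
  case differ_neg =>
    intro k w c e c' e'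
    by_cases hne : M.valueOfFormula ν ge c (decodeEnv d i e) =
      M.valueOfFormula ν ge c' (decodeEnv d i e')
    · exact Or.inr (Or.inr (hge _ _ _ _ _ _ hne))
    · have := hdif c e c' e' hne
      tauto
  case ge_total => exact fun k w w' => htotal _ _ _
  case ge_trans => exact fun k w w' w'' => htrans _ _ _ _

theorem preorderValid_of_entailed {c : ℕ} {φ : Formula σ} (hc : FormulaCode ν c φ)
    (h : Entailed c) : PreorderValid.{u, v} φ := by
  refine fun M d => Set.eq_univ_of_forall fun w => ?_
  -- A number naming no index gets the universal relation, which is still a total preorder.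
  let ge (k : ℕ) (w w' : M.W) : Prop := ∀ X, ν.index k = some X → M.ge X w w'
  obtain ⟨v, hv, hvc⟩ := M.toCore.exists_describes ν ge (fun k w X _ => M.ge_refl X w)
    (fun k w w' w'' h h' X hX => M.ge_trans X _ _ _ (h X hX) (h' X hX))
    (fun k w w' => by
      by_cases hX : ∃ X, ν.index k = some X
      · obtain ⟨X, hX⟩ := hX
        refine (M.ge_total X w w').imp ?_ ?_ <;>
        · intro h Y hY
          rwa [Option.some_inj.1 (hY.symm.trans hX)]
      · exact Or.inl fun X hX' => absurd ⟨X, hX'⟩ hX) d w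
  have hw := (hvc c).1 (h v hv)
  rwa [M.toCore.valueOfFormula_eq ν (ge' := M.ge) ?_ hc] at hw
  intro k X hX
  funext w w'
  exact propext ⟨fun h => h X hX, fun h Y hY => Option.some_inj.1 (hX.symm.trans hY) ▸ h⟩

theorem utilityValid_of_preorderValid {φ : Formula σ} (h : PreorderValid.{u, v} φ) :
    UtilityValid.{u, v} φ := fun M d =>
  h { M.toCore with
      ge := fun X w w' => M.util X w ≥ M.util X w'
      ge_refl := fun _ _ => le_rfl
      ge_trans := fun _ _ _ _ h h' => le_trans h' h
      ge_total := fun _ _ _ => le_total _ _ } d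

end Soundness

-- Completeness: every describing valuation gives a utility model

section Completeness

open Encodable

variable {σ : Signature} (ν : EffectiveEnumeration σ)

/-- Identifying indifferent elements leaves a countable linear order, which embeds in the dense
order `ℝ`. -/
theorem exists_utility {α : Type v} [Countable α] (r : α → α → Prop)
    (htrans : ∀ a b c, r a b → r b c → r a c) (htotal : ∀ a b, r a b ∨ r b a) :
    ∃ f : α → ℝ, ∀ a b, r a b ↔ f b ≤ f a := by
  classical
  let _ : Preorder α :=
    { le := fun a b => r b a
      le_refl := fun a => (htotal a a).elim id id
      le_trans := fun a b c h h' => htrans c b a h' h }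
  have : Std.Total (α := α) (· ≤ ·) := ⟨fun a b => htotal b a⟩
  have : Countable (Antisymmetrization α (· ≤ ·)) :=
    (Quotient.mk_surjective (s := AntisymmRel.setoid α (· ≤ ·))).countable
  obtain ⟨g⟩ := Order.embedding_from_countable_to_dense (Antisymmetrization α (· ≤ ·)) ℝ
  refine ⟨fun a => g (toAntisymmetrization _ a), fun a b => ?_⟩
  rw [g.le_iff_le, toAntisymmetrization_le_toAntisymmetrization_iff]
  rfl

/-- The code of a term in which each function symbol is coded by a chosen name of it. -/
noncomputable def codeOfTerm : σ.Term → ℕ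
  | .var x => Nat.pair 0 x
  | @FirstOrder.Language.Term.func _ _ n f ts =>
    Nat.pair 1 (Nat.pair (ν.func_surj ⟨n, f⟩).choose
      (encode (List.ofFn fun i => codeOfTerm (ts i))))

/-- The code of a formula in which each symbol and each index is coded by a chosen name of it. -/
noncomputable def codeOfFormula : Formula σ → ℕ
  | .equal s t => Nat.pair 0 (Nat.pair (codeOfTerm ν s) (codeOfTerm ν t))
  | @Formula.rel _ n R ts =>
    Nat.pair 1 (Nat.pair (ν.rel_surj ⟨n, R⟩).choose
      (encode (List.ofFn fun i => codeOfTerm ν (ts i))))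
  | .neg φ => Nat.pair 2 (codeOfFormula φ)
  | .conj φ ψ => Nat.pair 3 (Nat.pair (codeOfFormula φ) (codeOfFormula ψ))
  | .ex x φ => Nat.pair 4 (Nat.pair x (codeOfFormula φ))
  | .pref X φ ψ =>
    Nat.pair 5 (Nat.pair (ν.index_surj X).choose (Nat.pair (codeOfFormula φ) (codeOfFormula ψ)))

theorem termCode_codeOfTerm (τ : σ.Term) : TermCode ν (codeOfTerm ν τ) τ := by
  induction τ with
  | var x => exact TermCode.var x
  | func f ts ih => exact TermCode.func (ν.func_surj ⟨_, f⟩).choose_spec ih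

theorem formulaCode_codeOfFormula (φ : Formula σ) : FormulaCode ν (codeOfFormula ν φ) φ := by
  induction φ with
  | equal s t => exact .equal (termCode_codeOfTerm ν s) (termCode_codeOfTerm ν t)
  | rel R ts =>
    exact .rel (ν.rel_surj ⟨_, R⟩).choose_spec fun i => termCode_codeOfTerm ν (ts i)
  | neg φ ih => exact .neg ih
  | conj φ ψ ihφ ihψ => exact .conj ihφ ihψ
  | ex x φ ih => exact .ex x ih
  | pref X φ ψ ihφ ihψ => exact .pref (ν.index_surj X).choose_spec ihφ ihψ

variable {v : List ℕ → Prop} (hv : Describes v)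

/-- Equality of individuals according to a valuation. -/
def Describes.setoid : Setoid ℕ where
  r a b := v (eqAtom a b)
  iseqv := ⟨hv.eq_refl, hv.eq_symm _ _, hv.eq_trans _ _ _⟩

/-- The individuals of the model described by a valuation. -/
def Describes.Individual : Type u := ULift.{u} (Quotient hv.setoid)

/-- The individual coded by a number. -/
def Describes.individual (a : ℕ) : Describes.Individual.{u} hv := ⟨Quotient.mk hv.setoid a⟩

/-- A code of an individual. -/
noncomputable def Describes.name (x : Describes.Individual.{u} hv) : ℕ := x.down.out

/-- A code of a tuple of individuals. -/
noncomputable def Describes.names {n : ℕ} (x : Fin n → Describes.Individual.{u} hv) : ℕ :=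
  encode (List.ofFn fun i => hv.name (x i))

theorem Describes.individual_eq_iff {a b : ℕ} :
    Describes.individual.{u} hv a = hv.individual b ↔ v (eqAtom a b) :=
  ULift.up_inj.trans (Quotient.eq (r := hv.setoid))

theorem Describes.individual_name (x : Describes.Individual.{u} hv) :
    hv.individual (hv.name x) = x :=
  congrArg ULift.up (Quotient.out_eq x.down)

open Classical in
/-- The model described by a valuation, without the utility functions. -/
noncomputable def Describes.core : Core.{u, v} σ where
  D := Describes.Individual.{u} hv
  W := ULift.{v} ℕ
  D_nonempty := ⟨hv.individual 0⟩
  W_nonempty := ⟨⟨0⟩⟩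
  t w :=
    { funMap := fun {n} f x => hv.individual <| Classical.epsilon fun a => ∃ l e,
        v (valsAtom w.down l e (hv.names x)) ∧
          v (valAtom w.down (Nat.pair 1 (Nat.pair (ν.func_surj ⟨n, f⟩).choose l)) e a)
      RelMap := fun {n} R x => ∃ l e, v (valsAtom w.down l e (hv.names x)) ∧
        v (trueAtom w.down (Nat.pair 1 (Nat.pair (ν.rel_surj ⟨n, R⟩).choose l)) e) }
  -- A proposition may have many descriptions, which can select different worlds. One description is
  -- chosen; the choice is harmless up to indifference by `Describes.ge_select`.
  s w A := if h : ∃ p : ℕ × ℕ, A.1 = {w' | v (trueAtom w'.down p.1 p.2)} then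
      ⟨selectCode w.down h.choose.1 h.choose.2⟩
    else A.2.some
  s_mem w A := by
    split_ifs with h
    · obtain ⟨w', hw'⟩ := A.2
      have hA := Set.ext_iff.1 h.choose_spec
      exact (hA _).2 (hv.select _ _ _ _ ((hA w').1 hw'))
    · exact A.2.some_mem

/-- The assignment coded by a number. -/
def Describes.assignment (e : ℕ) : ℕ → Describes.Individual.{u} hv :=
  decodeEnv (fun x => hv.individual (Nat.pair 0 x)) hv.individual e

theorem Describes.assignment_updateCode (x a e : ℕ) :
    Describes.assignment.{u} hv (updateCode x a e) =
      Function.update (hv.assignment e) x (hv.individual a) :=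
  decodeEnv_updateCode _ _ _ _ _

theorem exists_updateCode (e : ℕ) : ∃ x a e', e' < e + 1 ∧ e + 1 = updateCode x a e' :=
  ⟨e.unpair.1.unpair.1, e.unpair.1.unpair.2, e.unpair.2,
    Nat.lt_succ_of_le (Nat.unpair_right_le _), by simp [updateCode, consCode]⟩

theorem Describes.exists_val_var (w x e : ℕ) : ∃ b, v (valAtom w (Nat.pair 0 x) e b) ∧
    Describes.assignment.{u} hv e x = hv.individual b := by
  induction e using Nat.strong_induction_on with
  | _ e ih =>
    cases e with
    | zero => exact ⟨_, hv.var_nil w x, by rw [Describes.assignment, decodeEnv_zero]⟩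
    | succ e =>
      obtain ⟨y, a, e', he', he⟩ := exists_updateCode e
      rw [he, Describes.assignment_updateCode]
      by_cases hxy : y = x
      · subst hxy
        exact ⟨a, hv.var_head _ _ _ _, Function.update_self ..⟩
      · obtain ⟨b, hb, hxb⟩ := ih e' he'
        exact ⟨b, hv.var_tail _ _ _ _ _ _ hxy hb, by
          rw [Function.update_of_ne (Ne.symm hxy), hxb]⟩

theorem Describes.val_iff {w t e b : ℕ} (hb : v (valAtom w t e b)) (a : ℕ) :
    v (valAtom w t e a) ↔ Describes.individual.{u} hv b = hv.individual a := by
  rw [Describes.individual_eq_iff]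
  exact ⟨hv.val_unique _ _ _ _ _ hb, hv.val_congr _ _ _ _ _ hb⟩

theorem Describes.vals_ofFn (hv : Describes v) {w e n : ℕ} {c b : Fin n → ℕ}
    (h : ∀ i, v (valAtom w (c i) e (b i))) :
    v (valsAtom w (encode (List.ofFn c)) e (encode (List.ofFn b))) := by
  induction n with
  | zero => simpa using hv.vals_nil w e
  | succ n ih =>
    rw [encode_list_ofFn_succ, encode_list_ofFn_succ]
    exact hv.vals_cons _ _ _ _ _ _ (h 0) (ih fun i => h i.succ)

/-- In the function case `val_total` supplies some value for the compound term, so the choice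
defining `funMap` succeeds, and `func_congr` transfers the chosen value to the term at hand. -/
theorem Describes.val_codeOfTerm (w e : ℕ) (τ : σ.Term) (a : ℕ) :
    v (valAtom w (codeOfTerm ν τ) e a) ↔
      (Describes.core.{u, v} ν hv).termVal ⟨w⟩ (hv.assignment e) τ = hv.individual a := by
  induction τ generalizing a with
  | var x =>
    obtain ⟨b, hb, hxb⟩ := Describes.exists_val_var.{u} hv w x e
    refine (Describes.val_iff.{u} hv hb a).trans ?_
    rw [← hxb]
    rfl
  | @func n f ts ih =>
    let x (i : Fin n) := (Describes.core.{u, v} ν hv).termVal ⟨w⟩ (hv.assignment e) (ts i)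
    have hx : v (valsAtom w (encode (List.ofFn fun i => codeOfTerm ν (ts i))) e (hv.names x)) :=
      hv.vals_ofFn fun i => (ih i _).2 (hv.individual_name _).symm
    let P (a : ℕ) : Prop := ∃ l e, v (valsAtom w l e (hv.names x)) ∧
      v (valAtom w (Nat.pair 1 (Nat.pair (ν.func_surj ⟨n, f⟩).choose l)) e a)
    have hP : P (Classical.epsilon P) :=
      Classical.epsilon_spec ⟨_, _, _, hx, hv.val_total _ _ _⟩
    obtain ⟨l, e', hl, ha⟩ := hP
    exact Describes.val_iff.{u} hv (hv.func_congr _ _ _ _ _ _ _ _ hl hx ha) a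

theorem Describes.val_name (w e : ℕ) (τ : σ.Term) :
    v (valAtom w (codeOfTerm ν τ) e
      (hv.name ((Describes.core.{u, v} ν hv).termVal ⟨w⟩ (hv.assignment e) τ))) :=
  (hv.val_codeOfTerm ν w e τ _).2 (hv.individual_name _).symm

/-- The preference relation described by a valuation. -/
def Describes.ge (X : σ.U) (w w' : ULift.{v} ℕ) : Prop :=
  v (geAtom (ν.index_surj X).choose w.down w'.down)

/-- Coextensive descriptions cannot disagree at their differing world, so the `differ` clauses force
preference; by symmetry of the hypothesis the selected worlds are indifferent. -/
theorem Describes.ge_select (hv : Describes v) (k w c e c' e' : ℕ)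
    (h : ∀ w', v (trueAtom w' c e) ↔ v (trueAtom w' c' e')) :
    v (geAtom k (selectCode w c e) (selectCode w c' e')) := by
  rcases hv.differ_neg k w c e c' e' with h' | h' | h'
  · exact hv.differ_pos _ _ _ _ _ _ h' ((h _).1 h')
  · exact hv.differ_pos _ _ _ _ _ _ ((h _).2 h') h'
  · exact h'

theorem Describes.core_s (w c e : ℕ) (A : {A : Set (ULift.{v} ℕ) // A.Nonempty})
    (hA : A.1 = {w' | v (trueAtom w'.down c e)}) :
    ∃ c' e', (Describes.core.{u, v} ν hv).s ⟨w⟩ A = ⟨selectCode w c' e'⟩ ∧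
      ∀ w', v (trueAtom w' c e) ↔ v (trueAtom w' c' e') := by
  have h : ∃ p : ℕ × ℕ, A.1 = {w' | v (trueAtom w'.down p.1 p.2)} := ⟨(c, e), hA⟩
  refine ⟨h.choose.1, h.choose.2, dif_pos h, fun w' => ?_⟩
  exact ((Set.ext_iff.1 hA ⟨w'⟩).symm.trans (Set.ext_iff.1 h.choose_spec ⟨w'⟩))

/-- The truth lemma, by induction on `φ`. For comparisons, the world selected in the model and the
one named by the formula come from coextensive descriptions, so transitivity replaces one by the
other. -/
theorem Describes.prop_eq (φ : Formula σ) (e : ℕ) :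
    (Describes.core.{u, v} ν hv).prop (Describes.ge.{v} ν (v := v)) φ (hv.assignment e) =
      {w | v (trueAtom w.down (codeOfFormula ν φ) e)} := by
  induction φ generalizing e with
  | equal s t =>
    ext ⟨w⟩
    have hs := hv.val_name.{u, v} ν w e s
    have ht := hv.val_name.{u, v} ν w e t
    constructor
    · intro h
      exact hv.equal_intro _ _ _ _ _ hs ((hv.val_codeOfTerm.{u, v} ν w e t _).2
        ((Eq.symm h).trans (hv.individual_name _).symm))
    · intro h
      have h' := (Describes.individual_eq_iff.{u} hv).2 (hv.equal_elim _ _ _ _ _ _ h hs ht)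
      exact (hv.individual_name _).symm.trans (h'.trans (hv.individual_name _))
  | @rel n R ts =>
    ext ⟨w⟩
    have hx := hv.vals_ofFn fun i => hv.val_name.{u, v} ν w e (ts i)
    constructor
    · rintro ⟨l, e', hl, h⟩
      exact hv.rel_congr _ _ _ _ _ _ _ hl hx h
    · exact fun h => ⟨_, _, hx, h⟩
  | neg φ ih =>
    refine (congrArg compl (ih e)).trans (Set.ext fun w => ⟨?_, ?_⟩)
    · exact (hv.neg_intro w.down _ e).resolve_right
    · exact hv.neg_elim w.down _ e
  | conj φ ψ ihφ ihψ =>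
    refine (congrArg₂ (· ∩ ·) (ihφ e) (ihψ e)).trans (Set.ext fun w => ⟨?_, ?_⟩)
    · exact fun h => hv.conj_intro _ _ _ _ h.1 h.2
    · exact fun h => ⟨hv.conj_left _ _ _ _ h, hv.conj_right _ _ _ _ h⟩
  | ex x φ ih =>
    have hx : ∀ a, (Describes.core.{u, v} ν hv).prop (Describes.ge.{v} ν (v := v)) φ
        (Function.update (hv.assignment e) x (hv.individual a)) =
          {w | v (trueAtom w.down (codeOfFormula ν φ) (updateCode x a e))} := fun a =>
      (congrArg ((Describes.core.{u, v} ν hv).prop (Describes.ge.{v} ν (v := v)) φ)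
        (hv.assignment_updateCode x a e).symm).trans (ih _)
    refine Set.ext fun w => ⟨?_, ?_⟩
    · rintro ⟨a, ha⟩
      obtain ⟨b, rfl⟩ : ∃ b, hv.individual b = a := ⟨_, hv.individual_name a⟩
      exact hv.ex_intro _ _ _ _ _ ((Set.ext_iff.1 (hx b) w).1 ha)
    · exact fun h => ⟨hv.individual _, (Set.ext_iff.1 (hx _) w).2 (hv.ex_elim _ _ _ _ h)⟩
  | pref X φ ψ ihφ ihψ =>
    refine Set.ext fun ⟨w⟩ => ?_
    have key : ∀ (hφ : ((Describes.core.{u, v} ν hv).prop (Describes.ge.{v} ν (v := v)) φ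
          (hv.assignment e)).Nonempty)
        (hψ : ((Describes.core.{u, v} ν hv).prop (Describes.ge.{v} ν (v := v)) ψ
          (hv.assignment e)).Nonempty), Describes.ge.{v} ν (v := v) X
        ((Describes.core.{u, v} ν hv).s ⟨w⟩ ⟨_, hφ⟩) ((Describes.core.{u, v} ν hv).s ⟨w⟩ ⟨_, hψ⟩) ↔
          v (geAtom (ν.index_surj X).choose (selectCode w (codeOfFormula ν φ) e)
            (selectCode w (codeOfFormula ν ψ) e)) := by
      intro hφ hψ
      obtain ⟨c, a, hs, hc⟩ := hv.core_s.{u, v} ν w _ _ ⟨_, hφ⟩ (ihφ e)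
      obtain ⟨c', a', hs', hc'⟩ := hv.core_s.{u, v} ν w _ _ ⟨_, hψ⟩ (ihψ e)
      refine (iff_of_eq (congrArg₂ (Describes.ge.{v} ν (v := v) X) hs hs')).trans ?_
      constructor
      · intro h
        exact hv.ge_trans _ _ _ _ (hv.ge_select _ _ _ _ _ _ hc)
          (hv.ge_trans _ _ _ _ h (hv.ge_select _ _ _ _ _ _ fun w' => (hc' w').symm))
      · intro h
        exact hv.ge_trans _ _ _ _ (hv.ge_select _ _ _ _ _ _ fun w' => (hc w').symm)
          (hv.ge_trans _ _ _ _ h (hv.ge_select _ _ _ _ _ _ hc'))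
    constructor
    · rintro ⟨hφ, hψ, h⟩
      obtain ⟨w₁, h₁⟩ := hφ
      obtain ⟨w₂, h₂⟩ := hψ
      exact hv.pref_intro _ _ _ _ _ (hv.select w _ _ _ ((Set.ext_iff.1 (ihφ e) w₁).1 h₁))
        (hv.select w _ _ _ ((Set.ext_iff.1 (ihψ e) w₂).1 h₂)) ((key _ _).1 h)
    · intro h
      exact ⟨⟨⟨_⟩, (Set.ext_iff.1 (ihφ e) ⟨_⟩).2 (hv.pref_left _ _ _ _ _ h)⟩,
        ⟨⟨_⟩, (Set.ext_iff.1 (ihψ e) ⟨_⟩).2 (hv.pref_right _ _ _ _ _ h)⟩,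
        (key _ _).2 (hv.pref_ge _ _ _ _ _ h)⟩

theorem entailed_of_utilityValid {φ : Formula σ} (h : UtilityValid.{u, v} φ) :
    Entailed (codeOfFormula ν φ) := by
  intro v hv
  choose f hf using fun X : σ.U => exists_utility (Describes.ge.{v} ν (v := v) X)
    (fun _ _ _ => hv.ge_trans _ _ _ _) (fun _ _ => hv.ge_total _ _ _)
  have hφ := h { hv.core.{u, v} ν with util := f } (hv.assignment 0)
  have hge : (fun (X : σ.U) (w w' : ULift.{v} ℕ) => f X w ≥ f X w') =
      Describes.ge.{v} ν (v := v) := by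
    funext X w w'
    exact propext (hf X w w').symm
  have heq := hv.prop_eq.{u, v} ν φ 0
  rw [← hge] at heq
  exact (Set.ext_iff.1 (heq.symm.trans hφ) ⟨0⟩).2 trivial

theorem rePred_and {α : Type} [Primcodable α] {p q : α → Prop} (hp : REPred p) (hq : REPred q) :
    REPred fun a => p a ∧ q a := by
  have h := Partrec.bind (f := fun a => Part.assert (p a) fun _ => Part.some ())
    (g := fun a _ => Part.assert (q a) fun _ => Part.some ()) hp
    (Partrec.comp (f := fun a => Part.assert (q a) fun _ => Part.some ()) hq Computable.fst).to₂
  exact h.dom_re.of_eq fun a => by simp [Part.bind_dom, Part.assert]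

/-- `Entailed` also holds of some numbers that code no formula, since the clauses never check
syntax; hence the intersection with the r.e. set of codes. -/
theorem effectivelyEnumerable_of_iff {S : Set (Formula σ)}
    (h₁ : ∀ c φ, FormulaCode ν c φ → Entailed c → φ ∈ S)
    (h₂ : ∀ φ ∈ S, Entailed (codeOfFormula ν φ)) : EffectivelyEnumerable ν S := by
  refine ⟨fun c => (∃ φ, FormulaCode ν c φ) ∧ Entailed c,
    rePred_and (rePred_formulaCode ν) rePred_entailed_formula, ?_, ?_⟩
  · rintro c ⟨⟨φ, hφ⟩, hc⟩
    exact ⟨φ, h₁ c φ hφ hc, hφ⟩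
  · exact fun φ hφ => ⟨_, ⟨⟨φ, formulaCode_codeOfFormula ν φ⟩, h₂ φ hφ⟩,
      formulaCode_codeOfFormula ν φ⟩

end Completeness

end PrefLogic

theorem proposition4p8 (σ : PrefLogic.Signature) (ν : PrefLogic.EffectiveEnumeration σ) :
    PrefLogic.EffectivelyEnumerable ν {φ | PrefLogic.PreorderValid.{u, v} φ} ∧
      PrefLogic.EffectivelyEnumerable ν {φ | PrefLogic.UtilityValid.{u, v} φ} :=
  ⟨PrefLogic.effectivelyEnumerable_of_iff ν
      (fun _ _ => PrefLogic.preorderValid_of_entailed ν)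
      fun _ h => PrefLogic.entailed_of_utilityValid.{u, v} ν
        (PrefLogic.utilityValid_of_preorderValid h),
    PrefLogic.effectivelyEnumerable_of_iff ν
      (fun _ _ hc h => PrefLogic.utilityValid_of_preorderValid
        (PrefLogic.preorderValid_of_entailed ν hc h))
      fun _ => PrefLogic.entailed_of_utilityValid.{u, v} ν⟩
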